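/- Let $G$ be an $r$-discrete groupoid, that is, a locally compact Hausdorff topological groupoid whose domain and range maps $d(x)=x^{-1}x$ and $r(x)=xx^{-1}$ are local homeomorphisms onto the unit space $G^0$. An \emph{open $G$-set} is an open subset of $G$ on which $d$ and $r$ are injective; the open $G$-sets form an inverse semigroup under $st=\{xy : x\in s,\ y\in t,\ d(x)=r(y)\}$ and $s^*=\{x^{-1}:x\in s\}$. Let $S$ be a full inverse semigroup of open $G$-sets: an inverse subsemigroup that is a base for the topology of $G$ and in which any two elements of the idempotent set $E_S$ have a common upper bound in $E_S$. Let $\beta$ be an action of $S$ on a $C^*$-algebra $B$: a semigroup homomorphism $s\mapsto\beta_s$ from $S$ to the partial automorphisms of $B$ (the $^*$-isomorphisms between closed two-sided ideals of $B$, under composition of partial maps) such that the domain ideals of the $\beta_s$ are upward-directed and have dense span in $B$. For $e\in E_S$ let $B_e$ be the domain of $\beta_e$; the domain of $\beta_s$ is $B_{d(s)}$, where $d(s)=s^*s$. Suppose there is an injective, nondegenerate $^*$-homomorphism $\phi:C_0(G^0)\to ZM(B)$ into the centre of the multiplier algebra of $B$ such that $$\phi(C_e)B=B_e\quad\text{for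 every } e\in E_S,\qquad C_e=\{f\in C_0(G^0): f=0 \text{ off } e\},$$ where, for $J\subset C_0(G^0)$, $\phi(J)B$ denotes the closed linear span of the products $\phi(f)b$, $f\in J$, $b\in B$, and nondegeneracy means $\phi(C_0(G^0))B=B$. Then there are an upper semicontinuous $C^*$-bundle $\mathcal A=\{A_u\}_{u\in G^0}$ over $G^0$ and an (isometric) $^*$-isomorphism $\Phi$ of $B$ onto the $C^*$-algebra $\Gamma_0(\mathcal A)$ of continuous sections vanishing at infinity, such that $\Phi(\phi(f)b)(u)=f(u)\,\Phi(b)(u)$ for $f\in C_0(G^0)$, $b\in B$, $u\in G^0$, and such that for every $u\in G^0$ the map $b\mapsto\Phi(b)(u)$ is a surjection of $B$ onto $A_u$ with kernel $K_u=\phi(\{f\in C_0(G^0): f(u)=0\})B$ (so $A_u\cong B/K_u$). Moreover, for every $x\in G$ there is a unique $^*$-homomorphism $\alpha_x:A_{d(x)}\to A_{r(x)}$ such that $$\alpha_x\bigl(\Phi(b)(d(x))\bigr)=\Phi(\beta_s(b))(r(x))\quad\text{for all } s\in S \text{ with } x\in s \text{ and all } b\in B_{d(s)},$$ and the family $\alpha=(\alpha_x)_{x\in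 G}$ is an action of $G$ on $\mathcal A$: $\alpha_u=\mathrm{id}_{A_u}$ for $u\in G^0$, $\alpha_{xy}=\alpha_x\alpha_y$ whenever $d(x)=r(y)$, and $(x,a)\mapsto\alpha_x(a)$ is continuous from $d^*\mathcal A=\{(x,a)\in G\times\mathcal A: a\in A_{d(x)}\}$ to $\mathcal A$. -/

import Mathlib

open Set Filter Topology
open scoped ZeroAtInfty MultiplierAlgebra

universe u v

/-! ## Topological groupoids -/

/-- A topological groupoid on the set of arrows `G`, with the units regarded as arrows.
`dom x = x⁻¹ x` and `ran x = x x⁻¹`. The product `gmul x y` is only meaningful when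
`dom x = ran y`: all axioms, and everything below, evaluate it on composable pairs only. -/
class TopGroupoid (G : Type*) [TopologicalSpace G] where
  dom : G → G
  ran : G → G
  gmul : G → G → G
  ginv : G → G
  dom_dom : ∀ x, dom (dom x) = dom x
  ran_dom : ∀ x, ran (dom x) = dom x
  dom_ran : ∀ x, dom (ran x) = ran x
  ran_ran : ∀ x, ran (ran x) = ran x
  dom_gmul : ∀ x y, dom x = ran y → dom (gmul x y) = dom y
  ran_gmul : ∀ x y, dom x = ran y → ran (gmul x y) = ran x
  gmul_assoc : ∀ x y z, dom x = ran y → dom y = ran z →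
    gmul (gmul x y) z = gmul x (gmul y z)
  gmul_dom : ∀ x, gmul x (dom x) = x
  ran_gmul_self : ∀ x, gmul (ran x) x = x
  dom_ginv : ∀ x, dom (ginv x) = ran x
  ran_ginv : ∀ x, ran (ginv x) = dom x
  ginv_gmul : ∀ x, gmul (ginv x) x = dom x
  gmul_ginv : ∀ x, gmul x (ginv x) = ran x
  continuous_gmul : ContinuousOn (fun p : G × G => gmul p.1 p.2) {p | dom p.1 = ran p.2}
  continuous_ginv : Continuous ginv

namespace TopGroupoid

/-- The unit space `G⁰`, with the subspace topology. -/
def units (G : Type*) [TopologicalSpace G] [TopGroupoid G] : Set G := {u | dom u = u}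

section
variable {G : Type*} [TopologicalSpace G] [TopGroupoid G]

/-- The domain map `d : G → G⁰`. -/
def d (x : G) : units G := ⟨dom x, dom_dom x⟩

/-- The range map `r : G → G⁰`. -/
def r (x : G) : units G := ⟨ran x, dom_ran x⟩

theorem d_gmul {x y : G} (h : d x = r y) : d (gmul x y) = d y :=
  Subtype.ext (dom_gmul x y (congrArg Subtype.val h))

theorem r_gmul {x y : G} (h : d x = r y) : r (gmul x y) = r x :=
  Subtype.ext (ran_gmul x y (congrArg Subtype.val h))

theorem d_unit (u : units G) : d (u : G) = u := Subtype.ext u.2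

theorem r_unit (u : units G) : r (u : G) = u := by
  apply Subtype.ext
  have h : dom (u : G) = u := u.2
  change ran (u : G) = u
  rw [← h, ran_dom]

/-- `s t = {x y : x ∈ s, y ∈ t, (x, y) composable}`. -/
def setMul (s t : Set G) : Set G :=
  {z | ∃ x ∈ s, ∃ y ∈ t, d x = r y ∧ z = gmul x y}

/-- `s* = {x⁻¹ : x ∈ s}`. -/
def setStar (s : Set G) : Set G := ginv '' s

/-- Open `G`-sets: open sets on which `r` and `d` are injective. -/
def IsOpenGSet (s : Set G) : Prop :=
  IsOpen s ∧ Set.InjOn (r : G → units G) s ∧ Set.InjOn (d : G → units G) s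

end

/-- `r`-discrete groupoids: locally compact Hausdorff, with `d` and `r` local homeomorphisms
onto the unit space. -/
class IsRDiscrete (G : Type*) [TopologicalSpace G] [TopGroupoid G] : Prop extends
    LocallyCompactSpace G, T2Space G where
  isLocalHomeomorph_d : IsLocalHomeomorph (d : G → units G)
  isLocalHomeomorph_r : IsLocalHomeomorph (r : G → units G)

/-- An inverse subsemigroup of the inverse semigroup of open `G`-sets. -/
structure InverseSubsemigroup (G : Type*) [TopologicalSpace G] [TopGroupoid G] where
  carrier : Set (Set G)
  isOpenGSet : ∀ s ∈ carrier, IsOpenGSet s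
  mul_mem : ∀ s ∈ carrier, ∀ t ∈ carrier, setMul s t ∈ carrier
  star_mem : ∀ s ∈ carrier, setStar s ∈ carrier

namespace InverseSubsemigroup

variable {G : Type*} [TopologicalSpace G] [TopGroupoid G]

/-- The elements of `S`, as a type. -/
abbrev Elem (S : InverseSubsemigroup G) : Type _ := {s : Set G // s ∈ S.carrier}

instance (S : InverseSubsemigroup G) : Mul S.Elem :=
  ⟨fun s t => ⟨setMul s.1 t.1, S.mul_mem _ s.2 _ t.2⟩⟩

instance (S : InverseSubsemigroup G) : Star S.Elem :=
  ⟨fun s => ⟨setStar s.1, S.star_mem _ s.2⟩⟩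

/-- The natural partial order of an inverse semigroup: `s ≤ t` iff `s = s s* t`. -/
def NatLE {S : InverseSubsemigroup G} (s t : S.Elem) : Prop := s = s * star s * t

/-- `S` is full: it is a base for the topology of `G`, and any two idempotents have a common
upper bound among the idempotents. -/
def IsFull (S : InverseSubsemigroup G) : Prop :=
  TopologicalSpace.IsTopologicalBasis S.carrier ∧
    ∀ e f : S.Elem, IsIdempotentElem e → IsIdempotentElem f →
      ∃ g : S.Elem, IsIdempotentElem g ∧ NatLE e g ∧ NatLE f g

end InverseSubsemigroup

end TopGroupoid

/-! ## Actions of inverse semigroups on C*-algebras -/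

/-- Closed two-sided ideals of a C*-algebra. -/
structure IsClosedIdeal {B : Type*} [NonUnitalCStarAlgebra B] (I : Set B) : Prop where
  isClosed : IsClosed I
  zero_mem : (0 : B) ∈ I
  add_mem : ∀ a ∈ I, ∀ b ∈ I, a + b ∈ I
  smul_mem : ∀ (c : ℂ), ∀ a ∈ I, c • a ∈ I
  mul_mem_left : ∀ (b : B), ∀ a ∈ I, b * a ∈ I
  mul_mem_right : ∀ (b : B), ∀ a ∈ I, a * b ∈ I

/-- Partial automorphisms of a C*-algebra: `*`-isomorphisms between two closed ideals. The values
of the underlying functions outside `source` and `target` are irrelevant. -/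
structure PartialAut (B : Type*) [NonUnitalCStarAlgebra B] extends PartialEquiv B B where
  source_ideal : IsClosedIdeal toPartialEquiv.source
  target_ideal : IsClosedIdeal toPartialEquiv.target
  map_add : ∀ a ∈ toPartialEquiv.source, ∀ b ∈ toPartialEquiv.source,
    toPartialEquiv (a + b) = toPartialEquiv a + toPartialEquiv b
  map_smul : ∀ (c : ℂ), ∀ a ∈ toPartialEquiv.source,
    toPartialEquiv (c • a) = c • toPartialEquiv a
  map_mul : ∀ a ∈ toPartialEquiv.source, ∀ b ∈ toPartialEquiv.source,
    toPartialEquiv (a * b) = toPartialEquiv a * toPartialEquiv b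
  map_star : ∀ a ∈ toPartialEquiv.source,
    toPartialEquiv (star a) = star (toPartialEquiv a)

/-- An action of a semigroup `S` on `B` by partial automorphisms: `β (s t)` and `β s ∘ β t` have
the same domain and agree there; the domain ideals are upward-directed and have dense span. -/
structure InverseSemigroupAction (S : Type*) [Mul S] (B : Type*) [NonUnitalCStarAlgebra B] where
  toFun : S → PartialAut B
  map_mul : ∀ s t : S, PartialEquiv.EqOnSource (toFun (s * t)).toPartialEquiv
    ((toFun t).toPartialEquiv.trans (toFun s).toPartialEquiv)
  directed : ∀ s t : S, ∃ g : S,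
    (toFun s).source ∪ (toFun t).source ⊆ (toFun g).source
  dense_span : Dense (Submodule.span ℂ (⋃ s : S, (toFun s).source) : Set B)

namespace InverseSemigroupAction
variable {S : Type*} [Mul S] {B : Type*} [NonUnitalCStarAlgebra B]

/-- The domain ideal of `β s`. For an idempotent `e` this is the ideal `B_e`, and for general `s`
it equals `B_{s* s}`. -/
def ideal (β : InverseSemigroupAction S B) (s : S) : Set B := (β.toFun s).source

/-- `β_s(b)`, meaningful for `b ∈ β.ideal s`. -/
noncomputable def act (β : InverseSemigroupAction S B) (s : S) (b : B) : B := (β.toFun s).toPartialEquiv b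

end InverseSemigroupAction

/-! ## Central multipliers and the associated ideals -/

/-- `ZM(B)`, the centre of the multiplier algebra of `B`. -/
noncomputable abbrev CentralMult (B : Type*) [NonUnitalCStarAlgebra B] :=
  NonUnitalStarSubalgebra.center ℂ 𝓜(ℂ, B)

section
variable {X : Type*} [TopologicalSpace X] {B : Type*} [NonUnitalCStarAlgebra B]

/-- The element `φ(f) b` of `B`: the multiplier `φ(f)` acts by its left component. -/
noncomputable def multAct (φ : C₀(X, ℂ) →⋆ₙₐ[ℂ] CentralMult B) (f : C₀(X, ℂ)) (b : B) : B :=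
  (φ f : 𝓜(ℂ, B)).fst b

/-- `φ(J) B`: the closed linear span of the products `φ(f) b` with `f ∈ J`, `b ∈ B`. -/
def multIdeal (φ : C₀(X, ℂ) →⋆ₙₐ[ℂ] CentralMult B) (J : Set C₀(X, ℂ)) : Set B :=
  closure (Submodule.span ℂ {c : B | ∃ f ∈ J, ∃ b : B, c = multAct φ f b} : Set B)

/-- `φ` is nondegenerate: `φ(C₀(X)) B` is all of `B`. -/
def MultNondegenerate (φ : C₀(X, ℂ) →⋆ₙₐ[ℂ] CentralMult B) : Prop :=
  multIdeal φ Set.univ = Set.univ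

/-- `I_u`, the functions vanishing at `u`. -/
def vanishAt (u : X) : Set C₀(X, ℂ) := {f | f u = 0}

end

/-- `C_e`, the functions in `C₀(G⁰)` vanishing off `e`. -/
def vanishOff {G : Type*} [TopologicalSpace G] [TopGroupoid G] (e : Set G) :
    Set C₀(TopGroupoid.units G, ℂ) :=
  {f | ∀ u : TopGroupoid.units G, (u : G) ∉ e → f u = 0}

/-! ## Upper semicontinuous C*-bundles -/

/-- The disjoint union of a family of fibres. (`Sigma` is avoided because it carries the
disjoint union topology.) -/
structure BundleTotal {X : Type*} (E : X → Type*) where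
  base : X
  val : E base

/-- The fibre product of the total space with itself over the base. -/
structure BundlePair {X : Type*} (E : X → Type*) where
  base : X
  val₁ : E base
  val₂ : E base

/-- The pull-back `{(y, a) : a ∈ E (f y)}` of a bundle along `f : Y → X`. -/
structure BundlePullback {Y X : Type*} (f : Y → X) (E : X → Type*) where
  base : Y
  val : E (f base)

/-- The fibre product has the topology of a subspace of the product. -/
instance {X : Type*} (E : X → Type*) [TopologicalSpace (BundleTotal E)] :
    TopologicalSpace (BundlePair E) :=
  TopologicalSpace.induced
    (fun p => ((⟨p.base, p.val₁⟩, ⟨p.base, p.val₂⟩) : BundleTotal E × BundleTotal E))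
    inferInstance

/-- The pull-back has the topology of a subspace of `Y × BundleTotal E`. -/
instance {Y X : Type*} [TopologicalSpace Y] (f : Y → X) (E : X → Type*)
    [TopologicalSpace (BundleTotal E)] : TopologicalSpace (BundlePullback f E) :=
  TopologicalSpace.induced
    (fun p => ((p.base, ⟨f p.base, p.val⟩) : Y × BundleTotal E)) inferInstance

/-- An upper semicontinuous C*-bundle over `X`: a family of C*-algebras, with a topology on their
disjoint union for which the projection is continuous and open, the norm is upper semicontinuous,
the algebraic operations are continuous, and `aᵢ → 0_x` whenever the base points of `aᵢ` tend to
`x` and `‖aᵢ‖ → 0`. (The projection is surjective since fibres contain `0`.) -/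
structure USCCStarBundle (X : Type v) [TopologicalSpace X] where
  Fiber : X → Type u
  [fiberAlgebra : ∀ x, NonUnitalCStarAlgebra (Fiber x)]
  [totalTopology : TopologicalSpace (BundleTotal Fiber)]
  continuous_proj : Continuous (fun a : BundleTotal Fiber => a.base)
  isOpenMap_proj : IsOpenMap (fun a : BundleTotal Fiber => a.base)
  upperSemicontinuous_norm : UpperSemicontinuous (fun a : BundleTotal Fiber => ‖a.val‖)
  continuous_add : Continuous
    (fun p : BundlePair Fiber => (⟨p.base, p.val₁ + p.val₂⟩ : BundleTotal Fiber))
  continuous_mul : Continuous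
    (fun p : BundlePair Fiber => (⟨p.base, p.val₁ * p.val₂⟩ : BundleTotal Fiber))
  continuous_smul : Continuous
    (fun p : ℂ × BundleTotal Fiber => (⟨p.2.base, p.1 • p.2.val⟩ : BundleTotal Fiber))
  continuous_star : Continuous
    (fun a : BundleTotal Fiber => (⟨a.base, star a.val⟩ : BundleTotal Fiber))
  tendsto_zero : ∀ (x : X) (l : Filter (BundleTotal Fiber)),
    Tendsto (fun a : BundleTotal Fiber => a.base) l (𝓝 x) →
    Tendsto (fun a : BundleTotal Fiber => ‖a.val‖) l (𝓝 0) → l ≤ 𝓝 ⟨x, 0⟩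

namespace USCCStarBundle

attribute [instance] USCCStarBundle.fiberAlgebra USCCStarBundle.totalTopology

variable {X : Type v} [TopologicalSpace X]

/-- `f` is a continuous section. -/
def IsContSection (A : USCCStarBundle X) (f : ∀ x, A.Fiber x) : Prop :=
  Continuous (fun x => (⟨x, f x⟩ : BundleTotal A.Fiber))

/-- `Γ₀(A)`: the `*`-algebra of continuous sections vanishing at infinity, with the pointwise
operations. -/
def Gamma0 (A : USCCStarBundle X) : NonUnitalStarSubalgebra ℂ (∀ x, A.Fiber x) where
  carrier := {f | A.IsContSection f ∧ Tendsto (fun x => ‖f x‖) (cocompact X) (𝓝 0)}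
  add_mem' := by
    rintro f g ⟨hf, hf0⟩ ⟨hg, hg0⟩
    refine ⟨?_, ?_⟩
    · exact A.continuous_add.comp
        (g := fun p : BundlePair A.Fiber => (⟨p.base, p.val₁ + p.val₂⟩ : BundleTotal A.Fiber))
        (f := fun x => ⟨x, f x, g x⟩) (continuous_induced_rng.2 (hf.prodMk hg))
    · refine squeeze_zero (fun x => norm_nonneg _) (fun x => norm_add_le (f x) (g x)) ?_
      simpa using hf0.add hg0
  zero_mem' := by
    refine ⟨continuous_iff_continuousAt.2 fun x => ?_, by simpa using tendsto_const_nhds⟩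
    refine A.tendsto_zero x _ (tendsto_map'_iff.2 tendsto_id) (tendsto_map'_iff.2 ?_)
    simp [Function.comp_def]
  mul_mem' := by
    rintro f g ⟨hf, hf0⟩ ⟨hg, hg0⟩
    refine ⟨?_, ?_⟩
    · exact A.continuous_mul.comp
        (g := fun p : BundlePair A.Fiber => (⟨p.base, p.val₁ * p.val₂⟩ : BundleTotal A.Fiber))
        (f := fun x => ⟨x, f x, g x⟩) (continuous_induced_rng.2 (hf.prodMk hg))
    · refine squeeze_zero (fun x => norm_nonneg _) (fun x => norm_mul_le (f x) (g x)) ?_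
      simpa using hf0.mul hg0
  smul_mem' := by
    rintro c f ⟨hf, hf0⟩
    refine ⟨?_, ?_⟩
    · exact A.continuous_smul.comp
        (g := fun p : ℂ × BundleTotal A.Fiber => (⟨p.2.base, p.1 • p.2.val⟩ : BundleTotal A.Fiber))
        (f := fun x => (c, ⟨x, f x⟩)) (continuous_const.prodMk hf)
    · simpa [norm_smul] using hf0.const_mul ‖c‖
  star_mem' := by
    rintro f ⟨hf, hf0⟩
    exact ⟨A.continuous_star.comp hf, by simpa using hf0⟩

/-- The identification of the fibres over equal points. -/
def fiberCast (A : USCCStarBundle X) {x y : X} (h : x = y) (a : A.Fiber x) : A.Fiber y := h ▸ a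

end USCCStarBundle

/-! ## Actions of groupoids on bundles -/

/-- The family `α x : A_{d(x)} → A_{r(x)}` of `*`-homomorphisms is an action of `G` on the bundle
`A`: a functor (it respects units and products), such that `(x, a) ↦ α x a` is continuous from the
pull-back `d^* A` to the total space of `A`. -/
structure IsGroupoidAction {G : Type*} [TopologicalSpace G] [TopGroupoid G]
    (A : USCCStarBundle (TopGroupoid.units G))
    (α : ∀ x : G, A.Fiber (TopGroupoid.d x) →⋆ₙₐ[ℂ] A.Fiber (TopGroupoid.r x)) : Prop where
  map_unit : ∀ (u : TopGroupoid.units G) (a : A.Fiber (TopGroupoid.d (u : G))),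
    A.fiberCast (TopGroupoid.r_unit u) (α u a) = A.fiberCast (TopGroupoid.d_unit u) a
  map_gmul : ∀ (x y : G) (h : TopGroupoid.d x = TopGroupoid.r y)
    (a : A.Fiber (TopGroupoid.d (TopGroupoid.gmul x y))),
    A.fiberCast (TopGroupoid.r_gmul h) (α (TopGroupoid.gmul x y) a) =
      α x (A.fiberCast h.symm (α y (A.fiberCast (TopGroupoid.d_gmul h) a)))
  continuous_act : Continuous
    (fun p : BundlePullback (TopGroupoid.d : G → TopGroupoid.units G) A.Fiber =>
      (⟨TopGroupoid.r p.base, α p.base p.val⟩ : BundleTotal A.Fiber))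

/-!
The fibre over a unit `u` is `A_u = B / K_u`, where `K_u = φ(I_u) B`. The multipliers `φ(f)`, with
`f` equal to `1` near `u` and concentrated near `u`, serve as local units: the quotient norm of `b`
at `u` is the infimum of the norms `‖φ(f) b‖` (`exists_norm_multAct_lt`,
`norm_multGerm_le_norm_multAct`). This gives the C*-identity in `B / K_u` without approximate units
of ideals, and the upper semicontinuity of `u ↦ ‖b + K_u‖`. The total space is topologized by tubes
around the sections `u ↦ b + K_u`, so that convergence to a point of such a section means that the
base points converge and the distance to the section tends to `0` (`tendsto_nhds_multGerm`); the
bundle axioms follow.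

The map from `B` to sections is isometric: if all germs of a selfadjoint `b` have norm below `c`,
cut `b` by a partition of unity into `n` pieces of norm at most `c`; this bounds `b ^ m` by
`n * c ^ m`, and `n` disappears on taking `m`-th roots for `m = 2 ^ k` (`norm_multAct_sum_le`). It is
surjective since partitions of unity make its range uniformly dense
(`exists_norm_multGerm_sum_sub_le`).

For `x ∈ s ∈ S` the map `α_x` sends the germ of `b ∈ B_{d(s)}` at `d(x)` to the germ of `β_s(b)` at
`r(x)`. That this is well defined is the main point
(`InverseSemigroupAction.IsCompatible.multGerm_act_eq_zero_of_multGerm_eq_zero`): if `b` vanishes at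
`d(x)`, it is within `ε` of a sum of elements in the domains of `β_t` with `t ⊆ s \ {x}`; `β_s`
agrees with `β_t` there and takes values in `B_{r(t)}`, which is contained in `K_{r(x)}` because
`r(x) ∉ r(t)`; and `β_s` is contractive. Functoriality is then inherited from `β`, and continuity
holds because each `α_x` is contractive and carries the section of `b` to that of `β_s(b)` over `s`.
-/

/-! ### Functions in `C₀(X)` subordinate to a cover -/

theorem ZeroAtInftyContinuousMap.finset_sum_apply {X : Type*} [TopologicalSpace X] {ι : Type*} (s : Finset ι) (h : ι → C₀(X, ℂ))
    (y : X) : (∑ i ∈ s, h i) y = ∑ i ∈ s, h i y := by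
  classical
  induction s using Finset.induction_on with
  | empty => simp
  | insert i s hi ih => simp [Finset.sum_insert hi, ih]

section Bump
variable {X : Type*} [TopologicalSpace X] [T2Space X] [LocallyCompactSpace X]

/-- Partition of unity on a compact set by elements of `C₀(X)`. The sum of the family is at most
`1` everywhere, also off the compact set; nonnegativity of a complex-valued function `h` is
expressed as `h y = ‖h y‖`. -/
theorem exists_zeroAtInfty_partition {t : Set X} (ht : IsCompact t) {U : X → Set X}
    (hU : ∀ x ∈ t, U x ∈ 𝓝 x) :
    ∃ (n : ℕ) (p : Fin n → X) (h : Fin n → C₀(X, ℂ)),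
      (∀ i, p i ∈ t) ∧ (∀ i y, h i y = (‖h i y‖ : ℂ)) ∧ (∀ i y, h i y ≠ 0 → y ∈ U (p i)) ∧
      (∀ y, ∑ i, ‖h i y‖ ≤ 1) ∧ ∀ y ∈ t, ∑ i, h i y = 1 := by
  classical
  obtain ⟨F, hF, htF⟩ := ht.elim_nhds_subcover (fun x => interior (U x))
    fun x hx => interior_mem_nhds.2 (hU x hx)
  let e := F.equivFin.symm
  let O : Set X := ⋃ i, interior (U (e i))
  have htO : t ⊆ O := fun y hy => by
    obtain ⟨x, hx, hyx⟩ := mem_iUnion₂.1 (htF hy)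
    exact mem_iUnion.2 ⟨F.equivFin ⟨x, hx⟩, by simpa [e] using hyx⟩
  -- `g` cuts the partition of unity of its support down to a sum that is at most `1`
  obtain ⟨g, hgO, hg1, hg01, hgc⟩ := exists_continuous_sum_one_of_isOpen_isCompact
    (s := fun _ : Fin 1 => O) (fun _ => isOpen_iUnion fun _ => isOpen_interior) ht
    (fun y hy => mem_iUnion.2 ⟨0, htO hy⟩)
  obtain ⟨k, hkU, hk1, hk01, -⟩ := exists_continuous_sum_one_of_isOpen_isCompact
    (s := fun i => interior (U (e i))) (fun _ => isOpen_interior) (hgc 0) (hgO 0)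
  have hval : ∀ i y, 0 ≤ k i y * g 0 y := fun i y => mul_nonneg (hk01 i y).1 (hg01 0 y).1
  have hsum : ∀ y, ∑ i, k i y * g 0 y = g 0 y := fun y => by
    rw [← Finset.sum_mul]
    by_cases hy : g 0 y = 0
    · simp [hy]
    · have := hk1 (subset_tsupport _ hy)
      simp only [Finset.sum_apply, Pi.one_apply] at this
      rw [this, one_mul]
  let h : Fin F.card → C₀(X, ℂ) := fun i =>
    { toFun := fun y => ((k i y * g 0 y : ℝ) : ℂ)
      continuous_toFun := by fun_prop
      zero_at_infty' := by
        have hc : HasCompactSupport fun y => ((k i y * g 0 y : ℝ) : ℂ) :=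
          ((hgc 0).mul_left (f := fun y => k i y)).comp_left Complex.ofReal_zero
        exact hc.is_zero_at_infty }
  have hh : ∀ i y, h i y = ((k i y * g 0 y : ℝ) : ℂ) := fun i y => rfl
  have hn : ∀ i y, ‖h i y‖ = k i y * g 0 y := fun i y => by
    rw [hh, Complex.norm_real, Real.norm_of_nonneg (hval i y)]
  refine ⟨F.card, fun i => e i, h, fun i => hF _ (e i).2, fun i y => by rw [hn, hh],
    fun i y hy => ?_, fun y => ?_, fun y hy => ?_⟩
  · refine interior_subset (hkU i (subset_tsupport _ fun h0 => hy ?_))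
    simp [hh, h0]
  · simp only [hn, hsum]
    exact (hg01 0 y).2
  · have := hg1 hy
    simp only [Finset.univ_unique, Fin.default_eq_zero, Finset.sum_singleton, Pi.one_apply] at this
    simp only [hh]
    rw [← Complex.ofReal_sum, hsum, this, Complex.ofReal_one]

theorem exists_zeroAtInfty_bump_of_isCompact {t U : Set X} (ht : IsCompact t) (hU : IsOpen U)
    (htU : t ⊆ U) :
    ∃ f : C₀(X, ℂ), (∀ y, f y = (‖f y‖ : ℂ)) ∧ (∀ y, ‖f y‖ ≤ 1) ∧ (∀ y, f y ≠ 0 → y ∈ U) ∧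
      ∀ y ∈ t, f y = 1 := by
  obtain ⟨n, p, h, -, hpos, hsupp, hle, h1⟩ :=
    exists_zeroAtInfty_partition (U := fun _ => U) ht fun x hx => hU.mem_nhds (htU hx)
  have hs : ∀ y, (∑ i, h i) y = ∑ i, h i y := fun y =>
    ZeroAtInftyContinuousMap.finset_sum_apply _ _ _
  have hsn : ∀ y, (∑ i, h i) y = ((∑ i, ‖h i y‖ : ℝ) : ℂ) := fun y => by
    rw [hs, Complex.ofReal_sum]
    exact Finset.sum_congr rfl fun i _ => hpos i y
  have hnn : ∀ y, ‖(∑ i, h i) y‖ = ∑ i, ‖h i y‖ := fun y => by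
    rw [hsn, Complex.norm_real, Real.norm_of_nonneg (Finset.sum_nonneg fun _ _ => norm_nonneg _)]
  refine ⟨∑ i, h i, fun y => by rw [hnn, hsn], fun y => (hnn y).trans_le (hle y), fun y hy => ?_,
    fun y hy => (hs y).trans (h1 y hy)⟩
  by_contra hyU
  refine hy ((hs y).trans (Finset.sum_eq_zero fun i _ => ?_))
  by_contra h0
  exact hyU (hsupp i y h0)

theorem exists_zeroAtInfty_bump {u : X} {U : Set X} (hU : U ∈ 𝓝 u) :
    ∃ f : C₀(X, ℂ), ‖f‖ ≤ 1 ∧ (∀ y, f y ≠ 0 → y ∈ U) ∧ ∀ᶠ y in 𝓝 u, f y = 1 := by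
  obtain ⟨V, hVU, hV, huV⟩ := mem_nhds_iff.1 hU
  obtain ⟨t, ht, hut, htV⟩ := exists_compact_subset hV huV
  obtain ⟨f, -, hf1, hfV, hft⟩ := exists_zeroAtInfty_bump_of_isCompact ht hV htV
  refine ⟨f, ?_, fun y hy => hVU (hfV y hy), ?_⟩
  · rw [← ZeroAtInftyContinuousMap.norm_toBCF_eq_norm]
    exact (BoundedContinuousFunction.norm_le zero_le_one).2 hf1
  · filter_upwards [mem_interior_iff_mem_nhds.1 hut] with y hy using hft y hy

end Bump

/-! ### The action of `C₀(X)` by central multipliers -/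

section MultAct
variable {X : Type*} [TopologicalSpace X] {B : Type*} [NonUnitalCStarAlgebra B]
  (φ : C₀(X, ℂ) →⋆ₙₐ[ℂ] CentralMult B)

@[simp] theorem multAct_add_left (f g : C₀(X, ℂ)) (b : B) :
    multAct φ (f + g) b = multAct φ f b + multAct φ g b := by
  simp [multAct]

@[simp] theorem multAct_sub_left (f g : C₀(X, ℂ)) (b : B) :
    multAct φ (f - g) b = multAct φ f b - multAct φ g b := by
  rw [eq_sub_iff_add_eq, ← multAct_add_left, sub_add_cancel]

@[simp] theorem multAct_smul_left (c : ℂ) (f : C₀(X, ℂ)) (b : B) :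
    multAct φ (c • f) b = c • multAct φ f b := by
  simp [multAct]

theorem multAct_mul_left (f g : C₀(X, ℂ)) (b : B) :
    multAct φ (f * g) b = multAct φ f (multAct φ g b) := by
  simp [multAct]

@[simp] theorem multAct_add_right (f : C₀(X, ℂ)) (a b : B) :
    multAct φ f (a + b) = multAct φ f a + multAct φ f b := by
  simp [multAct]

@[simp] theorem multAct_sub_right (f : C₀(X, ℂ)) (a b : B) :
    multAct φ f (a - b) = multAct φ f a - multAct φ f b := by
  simp [multAct]

@[simp] theorem multAct_smul_right (f : C₀(X, ℂ)) (c : ℂ) (b : B) :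
    multAct φ f (c • b) = c • multAct φ f b := by
  simp [multAct]

theorem continuous_multAct (f : C₀(X, ℂ)) : Continuous (multAct φ f) :=
  (φ f : 𝓜(ℂ, B)).fst.continuous

theorem norm_centralMult_le (f : C₀(X, ℂ)) : ‖(φ f : 𝓜(ℂ, B))‖ ≤ ‖f‖ :=
  NonUnitalStarAlgHom.norm_apply_le
    ((NonUnitalStarSubalgebraClass.subtype (CentralMult B)).comp φ) f

theorem norm_multAct_le (f : C₀(X, ℂ)) (b : B) : ‖multAct φ f b‖ ≤ ‖f‖ * ‖b‖ := by
  refine ((φ f : 𝓜(ℂ, B)).fst.le_opNorm b).trans ?_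
  rw [DoubleCentralizer.norm_fst]
  gcongr
  exact norm_centralMult_le φ f

/-- The multiplier `φ(f)` commutes with the copy of `B` inside the multiplier algebra. -/
theorem centralMult_mul_coe_comm (f : C₀(X, ℂ)) (b : B) :
    (φ f : 𝓜(ℂ, B)) * (b : 𝓜(ℂ, B)) = (b : 𝓜(ℂ, B)) * (φ f : 𝓜(ℂ, B)) :=
  ((NonUnitalStarSubalgebra.mem_center_iff.1 (φ f).2) _).symm

theorem multAct_mul_eq_mul_multAct (f : C₀(X, ℂ)) (a b : B) :
    multAct φ f (a * b) = a * multAct φ f b := by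
  have := congrArg (fun T : 𝓜(ℂ, B) => T.fst b) (centralMult_mul_coe_comm φ f a)
  simpa [multAct] using this

theorem eq_of_forall_mul_left_eq {a b : B} (h : ∀ x : B, x * a = x * b) : a = b := by
  rw [← sub_eq_zero, ← CStarRing.star_mul_self_eq_zero_iff, mul_sub, h, sub_self]

/-- For a double centralizer `(L, R)` one has `x * L y = R x * y`, which moves `L` past the right
factor. -/
theorem multAct_mul (f : C₀(X, ℂ)) (a b : B) :
    multAct φ f (a * b) = multAct φ f a * b := by
  refine eq_of_forall_mul_left_eq fun x => ?_
  have h1 : ∀ y, x * multAct φ f y = (φ f : 𝓜(ℂ, B)).snd x * y := fun y =>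
    ((φ f : 𝓜(ℂ, B)).central x y).symm
  rw [h1, ← mul_assoc, ← h1, mul_assoc]

/-- Both components of a central double centralizer agree. -/
theorem snd_centralMult (f : C₀(X, ℂ)) (b : B) : (φ f : 𝓜(ℂ, B)).snd b = multAct φ f b := by
  rw [← star_inj]
  refine eq_of_forall_mul_left_eq fun x => ?_
  rw [← star_inj]
  simp only [star_mul, star_star]
  have h1 := (φ f : 𝓜(ℂ, B)).central b (star x)
  rw [h1]
  change b * multAct φ f (star x) = _
  rw [← multAct_mul_eq_mul_multAct, multAct_mul]

theorem star_multAct (f : C₀(X, ℂ)) (b : B) :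
    star (multAct φ f b) = multAct φ (star f) (star b) := by
  have h : multAct φ (star f) (star b) = star ((φ f : 𝓜(ℂ, B)).snd b) := by
    simp [multAct, map_star]
  rw [h, snd_centralMult]

/-- `φ(J) B` as a closed subspace. -/
def multSubmodule (J : Set C₀(X, ℂ)) : Submodule ℂ B :=
  (Submodule.span ℂ {c : B | ∃ f ∈ J, ∃ b : B, c = multAct φ f b}).topologicalClosure

theorem coe_multSubmodule (J : Set C₀(X, ℂ)) : (multSubmodule φ J : Set B) = multIdeal φ J :=
  Submodule.topologicalClosure_coe _

theorem mem_multSubmodule {J : Set C₀(X, ℂ)} {b : B} :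
    b ∈ multSubmodule φ J ↔ b ∈ multIdeal φ J := by
  rw [← coe_multSubmodule, SetLike.mem_coe]

theorem isClosed_multSubmodule (J : Set C₀(X, ℂ)) : IsClosed (multSubmodule φ J : Set B) :=
  Submodule.isClosed_topologicalClosure _

variable {φ}

theorem multAct_mem_multSubmodule {J : Set C₀(X, ℂ)} {f : C₀(X, ℂ)} (hf : f ∈ J) (b : B) :
    multAct φ f b ∈ multSubmodule φ J :=
  Submodule.le_topologicalClosure _ (Submodule.subset_span ⟨f, hf, b, rfl⟩)

theorem multSubmodule_le {J : Set C₀(X, ℂ)} {C : Submodule ℂ B} (hC : IsClosed (C : Set B))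
    (h : ∀ f ∈ J, ∀ b, multAct φ f b ∈ C) : multSubmodule φ J ≤ C :=
  Submodule.topologicalClosure_minimal _
    (Submodule.span_le.2 (by rintro _ ⟨f, hf, b, rfl⟩; exact h f hf b)) hC

theorem multSubmodule_mono {J J' : Set C₀(X, ℂ)} (h : J ⊆ J') :
    multSubmodule φ J ≤ multSubmodule φ J' :=
  multSubmodule_le (isClosed_multSubmodule φ J') fun _ hf b => multAct_mem_multSubmodule (h hf) b

theorem mul_mem_left_multSubmodule {J : Set C₀(X, ℂ)} (a : B) {b : B}
    (hb : b ∈ multSubmodule φ J) : a * b ∈ multSubmodule φ J := by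
  have : multSubmodule φ J ≤ (multSubmodule φ J).comap (LinearMap.mulLeft ℂ a) :=
    multSubmodule_le ((isClosed_multSubmodule φ J).preimage (continuous_const_mul a))
      fun f hf b => by
        change a * multAct φ f b ∈ multSubmodule φ J
        rw [← multAct_mul_eq_mul_multAct]
        exact multAct_mem_multSubmodule hf _
  exact this hb

theorem mul_mem_right_multSubmodule {J : Set C₀(X, ℂ)} (a : B) {b : B}
    (hb : b ∈ multSubmodule φ J) : b * a ∈ multSubmodule φ J := by
  have : multSubmodule φ J ≤ (multSubmodule φ J).comap (LinearMap.mulRight ℂ a) :=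
    multSubmodule_le ((isClosed_multSubmodule φ J).preimage (continuous_mul_const a))
      fun f hf b => by
        change multAct φ f b * a ∈ multSubmodule φ J
        rw [← multAct_mul]
        exact multAct_mem_multSubmodule hf _
  exact this hb

theorem star_mem_multSubmodule {J : Set C₀(X, ℂ)} (hJ : ∀ f ∈ J, star f ∈ J) {b : B}
    (hb : b ∈ multSubmodule φ J) : star b ∈ multSubmodule φ J := by
  have : multSubmodule φ J ≤
      { carrier := {b | star b ∈ multSubmodule φ J}
        add_mem' := fun {a b} ha hb => by
          simpa only [mem_ofPred_eq, star_add] using add_mem ha hb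
        zero_mem' := by simp
        smul_mem' := fun c b hb => by
          simpa only [mem_ofPred_eq, star_smul] using Submodule.smul_mem _ (star c) hb } :=
    multSubmodule_le ((isClosed_multSubmodule φ J).preimage continuous_star)
      fun f hf b => by
        change star (multAct φ f b) ∈ multSubmodule φ J
        rw [star_multAct]
        exact multAct_mem_multSubmodule (hJ f hf) _
  exact this hb

/-- An approximation principle: on `φ(J) B` the multiplier `φ(g)` is close to the scalar `c` as
soon as multiplication by `g` is close to `c` on finitely many elements of `J`. -/
theorem exists_finset_norm_multAct_sub_le {J : Set C₀(X, ℂ)} {b : B}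
    (hb : b ∈ multSubmodule φ J) {ε : ℝ} (hε : 0 < ε) :
    ∃ F : Finset C₀(X, ℂ), ↑F ⊆ J ∧ ∃ δ > 0, ∀ (g : C₀(X, ℂ)) (c : ℂ), ‖g‖ ≤ 1 → ‖c‖ ≤ 1 →
      (∀ f ∈ F, ‖g * f - c • f‖ ≤ δ) → ‖multAct φ g b - c • b‖ ≤ ε := by
  classical
  let P : B → Prop := fun b => ∀ ε > 0, ∃ F : Finset C₀(X, ℂ), ↑F ⊆ J ∧ ∃ δ > 0,
    ∀ (g : C₀(X, ℂ)) (c : ℂ), ‖g‖ ≤ 1 → ‖c‖ ≤ 1 →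
      (∀ f ∈ F, ‖g * f - c • f‖ ≤ δ) → ‖multAct φ g b - c • b‖ ≤ ε
  have hspan : ∀ b ∈ Submodule.span ℂ {c : B | ∃ f ∈ J, ∃ b : B, c = multAct φ f b}, P b := by
    intro b hb
    induction hb using Submodule.span_induction with
    | mem x hx =>
      obtain ⟨f, hf, b, rfl⟩ := hx
      intro ε hε
      refine ⟨{f}, by simpa using hf, ε / (‖b‖ + 1), by positivity, fun g c _ _ h => ?_⟩
      rw [← multAct_mul_left, ← multAct_smul_left, ← multAct_sub_left]
      refine (norm_multAct_le φ _ b).trans ?_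
      have := h f (Finset.mem_singleton_self f)
      calc _ ≤ ε / (‖b‖ + 1) * (‖b‖ + 1) := by gcongr; linarith
        _ = ε := by field_simp
    | zero => exact fun ε hε => ⟨∅, by simp, 1, one_pos, fun g c _ _ _ => by
        simpa [multAct] using hε.le⟩
    | add x y _ _ hx hy =>
      intro ε hε
      obtain ⟨F, hF, δ, hδ, h⟩ := hx (ε / 2) (half_pos hε)
      obtain ⟨F', hF', δ', hδ', h'⟩ := hy (ε / 2) (half_pos hε)
      refine ⟨F ∪ F', by simp [hF, hF'], min δ δ', lt_min hδ hδ', fun g c hg hc H => ?_⟩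
      have h1 := h g c hg hc fun f hf =>
        (H f (Finset.mem_union_left _ hf)).trans (min_le_left _ _)
      have h2 := h' g c hg hc fun f hf =>
        (H f (Finset.mem_union_right _ hf)).trans (min_le_right _ _)
      have : multAct φ g (x + y) - c • (x + y) =
          (multAct φ g x - c • x) + (multAct φ g y - c • y) := by
        rw [multAct_add_right, smul_add]; abel
      rw [this]
      exact (norm_add_le _ _).trans (by linarith)
    | smul a x _ hx =>
      intro ε hε
      obtain ⟨F, hF, δ, hδ, h⟩ := hx (ε / (‖a‖ + 1)) (by positivity)
      refine ⟨F, hF, δ, hδ, fun g c hg hc H => ?_⟩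
      rw [multAct_smul_right, smul_comm, ← smul_sub, norm_smul]
      calc ‖a‖ * ‖multAct φ g x - c • x‖ ≤ (‖a‖ + 1) * (ε / (‖a‖ + 1)) := by
            gcongr
            · linarith
            · exact h g c hg hc H
        _ = ε := by field_simp
  have hcl : b ∈ closure
      (Submodule.span ℂ {c : B | ∃ f ∈ J, ∃ b : B, c = multAct φ f b} : Set B) := hb
  obtain ⟨a, ha, hab⟩ := Metric.mem_closure_iff.1 hcl (ε / 3) (by positivity)
  obtain ⟨F, hF, δ, hδ, h⟩ := hspan a ha (ε / 3) (by positivity)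
  refine ⟨F, hF, δ, hδ, fun g c hg hc H => ?_⟩
  have h1 := h g c hg hc H
  have h2 : multAct φ g b - c • b =
      multAct φ g (b - a) + (multAct φ g a - c • a) - c • (b - a) := by
    rw [multAct_sub_right, smul_sub]; abel
  rw [dist_eq_norm] at hab
  have h3 : ‖multAct φ g (b - a)‖ ≤ ‖b - a‖ :=
    (norm_multAct_le φ g _).trans (mul_le_of_le_one_left (norm_nonneg _) hg)
  have h4 : ‖c • (b - a)‖ ≤ ‖b - a‖ := by
    rw [norm_smul]; exact mul_le_of_le_one_left (norm_nonneg _) hc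
  rw [h2]
  refine (norm_sub_le _ _).trans ?_
  have := norm_add_le (multAct φ g (b - a)) (multAct φ g a - c • a)
  linarith

end MultAct

/-! ### The fibres -/

section Fiber
variable {X : Type*} [TopologicalSpace X] {B : Type*} [NonUnitalCStarAlgebra B]
  (φ : C₀(X, ℂ) →⋆ₙₐ[ℂ] CentralMult B)

/-- The fibre `B / φ(I_u) B` over `u`. -/
def MultFiber (u : X) : Type _ := B ⧸ multSubmodule φ (vanishAt u)

/-- The class of `b` in the fibre over `u`. -/
def multGerm (u : X) (b : B) : MultFiber φ u := Submodule.Quotient.mk b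

/-! Nondegeneracy of `φ` is carried as a `Fact` further on, because the fibres are C*-algebras only
under that assumption and their structure has to be found by instance search. -/

instance instIsClosedMultSubmodule (J : Set C₀(X, ℂ)) :
    IsClosed (multSubmodule φ J : Set B) := isClosed_multSubmodule φ J

noncomputable instance instMultFiberNormedAddCommGroup (u : X) :
    NormedAddCommGroup (MultFiber φ u) :=
  inferInstanceAs (NormedAddCommGroup (B ⧸ multSubmodule φ (vanishAt u)))

noncomputable instance instMultFiberNormedSpace (u : X) : NormedSpace ℂ (MultFiber φ u) :=
  inferInstanceAs (NormedSpace ℂ (B ⧸ multSubmodule φ (vanishAt u)))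

instance instMultFiberCompleteSpace (u : X) : CompleteSpace (MultFiber φ u) :=
  inferInstanceAs (CompleteSpace (B ⧸ multSubmodule φ (vanishAt u)))

variable {φ}

theorem multGerm_surjective (u : X) : Function.Surjective (multGerm φ u) :=
  Submodule.Quotient.mk_surjective _

theorem multGerm_eq_iff {u : X} {a b : B} :
    multGerm φ u a = multGerm φ u b ↔ a - b ∈ multSubmodule φ (vanishAt u) :=
  Submodule.Quotient.eq _

theorem multGerm_eq_zero_iff {u : X} {b : B} :
    multGerm φ u b = 0 ↔ b ∈ multSubmodule φ (vanishAt u) :=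
  Submodule.Quotient.mk_eq_zero _

theorem multGerm_add (u : X) (a b : B) :
    multGerm φ u (a + b) = multGerm φ u a + multGerm φ u b := rfl

theorem multGerm_sub (u : X) (a b : B) :
    multGerm φ u (a - b) = multGerm φ u a - multGerm φ u b := rfl

theorem multGerm_smul (u : X) (c : ℂ) (b : B) : multGerm φ u (c • b) = c • multGerm φ u b := rfl

theorem multGerm_zero (u : X) : multGerm φ u (0 : B) = 0 := rfl

theorem multGerm_sum (u : X) {ι : Type*} (s : Finset ι) (b : ι → B) :
    multGerm φ u (∑ i ∈ s, b i) = ∑ i ∈ s, multGerm φ u (b i) :=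
  map_sum (⟨⟨multGerm φ u, rfl⟩, multGerm_add u⟩ : B →+ MultFiber φ u) b s

theorem norm_multGerm_le (u : X) (b : B) : ‖multGerm φ u b‖ ≤ ‖b‖ :=
  Submodule.Quotient.norm_mk_le _ b

theorem exists_norm_lt_of_norm_multGerm_lt {u : X} {a : MultFiber φ u} {c : ℝ} (h : ‖a‖ < c) :
    ∃ b, multGerm φ u b = a ∧ ‖b‖ < c := by
  obtain ⟨b, hb, hlt⟩ := Submodule.Quotient.norm_mk_lt (S := multSubmodule φ (vanishAt u)) a
    (sub_pos.2 h)
  exact ⟨b, hb, hlt.trans_eq (add_sub_cancel _ _)⟩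

theorem star_mem_vanishAt {u : X} {f : C₀(X, ℂ)} (hf : f ∈ vanishAt u) : star f ∈ vanishAt u := by
  have : f u = 0 := hf
  change (star f) u = 0
  simp [this]

variable (φ)

noncomputable instance instMultFiberMul (u : X) : Mul (MultFiber φ u) where
  mul := Quotient.map₂ (· * ·) fun a a' ha b b' hb => by
    rw [← Quotient.eq_iff_equiv] at *
    have ha' := multGerm_eq_iff.1 ha
    have hb' := multGerm_eq_iff.1 hb
    refine multGerm_eq_iff.2 ?_
    have : a * b - a' * b' = a * (b - b') + (a - a') * b' := by
      rw [mul_sub, sub_mul]; abel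
    rw [this]
    exact add_mem (mul_mem_left_multSubmodule a hb') (mul_mem_right_multSubmodule b' ha')

noncomputable instance instMultFiberStar (u : X) : Star (MultFiber φ u) where
  star := Quotient.map star fun a a' ha => by
    rw [← Quotient.eq_iff_equiv] at *
    have ha' := multGerm_eq_iff.1 ha
    refine multGerm_eq_iff.2 ?_
    rw [← star_sub]
    exact star_mem_multSubmodule (fun _ => star_mem_vanishAt) ha'

variable {φ}

theorem multGerm_mul (u : X) (a b : B) :
    multGerm φ u (a * b) = multGerm φ u a * multGerm φ u b := rfl

theorem multGerm_star (u : X) (b : B) : multGerm φ u (star b) = star (multGerm φ u b) := rfl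

variable (φ)

noncomputable instance instMultFiberNonUnitalNormedRing (u : X) :
    NonUnitalNormedRing (MultFiber φ u) :=
  { instMultFiberNormedAddCommGroup φ u, instMultFiberMul φ u with
    left_distrib := fun a b c => by
      obtain ⟨a, rfl⟩ := multGerm_surjective u a
      obtain ⟨b, rfl⟩ := multGerm_surjective u b
      obtain ⟨c, rfl⟩ := multGerm_surjective u c
      exact congrArg (multGerm φ u) (mul_add a b c)
    right_distrib := fun a b c => by
      obtain ⟨a, rfl⟩ := multGerm_surjective u a
      obtain ⟨b, rfl⟩ := multGerm_surjective u b
      obtain ⟨c, rfl⟩ := multGerm_surjective u c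
      exact congrArg (multGerm φ u) (add_mul a b c)
    zero_mul := fun a => by
      obtain ⟨a, rfl⟩ := multGerm_surjective u a
      exact congrArg (multGerm φ u) (zero_mul a)
    mul_zero := fun a => by
      obtain ⟨a, rfl⟩ := multGerm_surjective u a
      exact congrArg (multGerm φ u) (mul_zero a)
    mul_assoc := fun a b c => by
      obtain ⟨a, rfl⟩ := multGerm_surjective u a
      obtain ⟨b, rfl⟩ := multGerm_surjective u b
      obtain ⟨c, rfl⟩ := multGerm_surjective u c
      exact congrArg (multGerm φ u) (mul_assoc a b c)
    dist_eq := (instMultFiberNormedAddCommGroup φ u).dist_eq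
    norm_mul_le := fun a b => by
      refine le_of_forall_gt_imp_ge_of_dense fun c hc => ?_
      -- both factors have representatives whose norms are as close as wanted
      have hlim : Tendsto (fun δ : ℝ => (‖a‖ + δ) * (‖b‖ + δ)) (𝓝[>] 0) (𝓝 (‖a‖ * ‖b‖)) := by
        have : Continuous fun δ : ℝ => (‖a‖ + δ) * (‖b‖ + δ) := by fun_prop
        simpa using (this.tendsto 0).mono_left nhdsWithin_le_nhds
      obtain ⟨δ, hδc, hδ⟩ := ((hlim.eventually (gt_mem_nhds hc)).and self_mem_nhdsWithin).exists
      obtain ⟨x, rfl, hx⟩ := exists_norm_lt_of_norm_multGerm_lt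
        (lt_add_of_pos_right ‖a‖ (mem_Ioi.1 hδ))
      obtain ⟨y, rfl, hy⟩ := exists_norm_lt_of_norm_multGerm_lt
        (lt_add_of_pos_right ‖b‖ (mem_Ioi.1 hδ))
      refine ((norm_multGerm_le u (x * y)).trans (norm_mul_le x y)).trans (le_trans ?_ hδc.le)
      gcongr }

end Fiber

/-! ### Norms of germs -/

section Norm
variable {X : Type*} [TopologicalSpace X] {B : Type*} [NonUnitalCStarAlgebra B]
  {φ : C₀(X, ℂ) →⋆ₙₐ[ℂ] CentralMult B}

theorem multSubmodule_univ [h : Fact (MultNondegenerate φ)] :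
    multSubmodule φ univ = ⊤ := by
  rw [← SetLike.coe_set_eq, coe_multSubmodule, Submodule.top_coe]
  exact h.out

/-- `φ(g)` almost fixes `b` if `g` is `1` on a large compact set. -/
theorem exists_isCompact_norm_multAct_sub_le [Fact (MultNondegenerate φ)] (b : B) {ε : ℝ}
    (hε : 0 < ε) : ∃ t : Set X, IsCompact t ∧ ∀ g : C₀(X, ℂ), (∀ y, ‖g y‖ ≤ 1) →
      (∀ y ∈ t, g y = 1) → ‖multAct φ g b - b‖ ≤ ε := by
  have hb : b ∈ multSubmodule φ univ := by rw [multSubmodule_univ]; trivial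
  obtain ⟨F, -, δ, hδ, h⟩ := exists_finset_norm_multAct_sub_le hb hε
  have hc : ∀ f : C₀(X, ℂ), ∃ t : Set X, IsCompact t ∧ ∀ y ∉ t, ‖f y‖ < δ / 2 := fun f => by
    have h0 : ‖(0 : ℂ)‖ < δ / 2 := by simpa using hδ
    have := f.zero_at_infty'.norm.eventually (gt_mem_nhds h0)
    obtain ⟨t, ht, hts⟩ := mem_cocompact.1 this
    exact ⟨t, ht, fun y hy => hts hy⟩
  choose t ht hts using hc
  refine ⟨⋃ f ∈ F, t f, F.isCompact_biUnion fun f _ => ht f, fun g hg hg1 => ?_⟩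
  have := h g 1 ?_ (by simp) fun f hf => ?_
  · simpa using this
  · rw [← ZeroAtInftyContinuousMap.norm_toBCF_eq_norm]
    exact (BoundedContinuousFunction.norm_le zero_le_one).2 hg
  · rw [← ZeroAtInftyContinuousMap.norm_toBCF_eq_norm]
    refine (BoundedContinuousFunction.norm_le hδ.le).2 fun y => ?_
    change ‖g y * f y - (1 : ℂ) * f y‖ ≤ δ
    by_cases hy : y ∈ t f
    · rw [hg1 y (mem_iUnion₂.2 ⟨f, hf, hy⟩)]
      simpa using hδ.le
    · rw [← sub_mul, norm_mul]
      have h2 : ‖g y - 1‖ ≤ 2 := (norm_sub_le _ _).trans (by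
        rw [norm_one]; linarith [hg y])
      calc _ ≤ 2 * (δ / 2) := by gcongr; exact (hts f y hy).le
        _ = δ := by ring

/-- On `φ(I_u) B`, the multipliers `φ(g)` with `g` concentrated near `u` are small. -/
theorem exists_nhds_norm_multAct_le {u : X} {k : B} (hk : k ∈ multSubmodule φ (vanishAt u))
    {ε : ℝ} (hε : 0 < ε) : ∃ U ∈ 𝓝 u, ∀ g : C₀(X, ℂ), ‖g‖ ≤ 1 → (∀ y, g y ≠ 0 → y ∈ U) →
      ‖multAct φ g k‖ ≤ ε := by
  obtain ⟨F, hF, δ, hδ, h⟩ := exists_finset_norm_multAct_sub_le hk hε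
  refine ⟨{y | ∀ f ∈ F, ‖f y‖ < δ}, ?_, fun g hg hgU => ?_⟩
  · refine (Finset.eventually_all F).2 fun f hf => ?_
    have hfu : f u = 0 := hF hf
    exact f.continuous.norm.continuousAt.eventually (gt_mem_nhds (by simpa [hfu] using hδ))
  · have := h g 0 hg (by simp) fun f hf => ?_
    · simpa using this
    · rw [← ZeroAtInftyContinuousMap.norm_toBCF_eq_norm]
      refine (BoundedContinuousFunction.norm_le hδ.le).2 fun y => ?_
      change ‖g y * f y - (0 : ℂ) * f y‖ ≤ δ
      rw [zero_mul, sub_zero, norm_mul]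
      by_cases hy : g y = 0
      · simpa [hy] using hδ.le
      · have hgy : ‖g y‖ ≤ 1 := (g.toBCF.norm_coe_le_norm y).trans
          ((ZeroAtInftyContinuousMap.norm_toBCF_eq_norm).trans_le hg)
        exact (mul_le_of_le_one_left (norm_nonneg _) hgy).trans (hgU y hy f hf).le

/-- The quotient norm is computed by localization at `u`: this replaces approximate units of the
ideal `φ(I_u) B`. -/
theorem exists_norm_multAct_lt [T2Space X] [LocallyCompactSpace X] {u : X} {b : B} {c : ℝ} (h : ‖multGerm φ u b‖ < c) :
    ∃ f : C₀(X, ℂ), ‖f‖ ≤ 1 ∧ (∀ᶠ y in 𝓝 u, f y = 1) ∧ ‖multAct φ f b‖ < c := by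
  obtain ⟨m, hm, hmc⟩ := exists_norm_lt_of_norm_multGerm_lt h
  obtain ⟨U, hU, hUg⟩ := exists_nhds_norm_multAct_le (multGerm_eq_iff.1 hm.symm)
    (half_pos (sub_pos.2 hmc))
  obtain ⟨f, hf1, hfU, hfu⟩ := exists_zeroAtInfty_bump hU
  refine ⟨f, hf1, hfu, ?_⟩
  have h1 := hUg f hf1 hfU
  have h2 : ‖multAct φ f m‖ ≤ ‖m‖ :=
    (norm_multAct_le φ f m).trans (mul_le_of_le_one_left (norm_nonneg _) hf1)
  rw [multAct_sub_right] at h1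
  have h3 := norm_le_norm_add_norm_sub' (multAct φ f b) (multAct φ f m)
  linarith

variable [Fact (MultNondegenerate φ)]

theorem multGerm_multAct (u : X) (f : C₀(X, ℂ)) (b : B) :
    multGerm φ u (multAct φ f b) = f u • multGerm φ u b := by
  rw [← multGerm_smul, multGerm_eq_iff]
  let L : B →ₗ[ℂ] B := (φ f : 𝓜(ℂ, B)).fst.toLinearMap - f u • LinearMap.id
  have hL : ∀ b, L b = multAct φ f b - f u • b := fun b => rfl
  have hLc : Continuous L := (continuous_multAct φ f).sub (continuous_const_smul (f u))
  have : multSubmodule φ univ ≤ (multSubmodule φ (vanishAt u)).comap L :=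
    multSubmodule_le ((isClosed_multSubmodule φ _).preimage hLc) fun g _ c => by
      rw [Submodule.mem_comap, hL, ← multAct_mul_left, ← multAct_smul_left, ← multAct_sub_left]
      exact multAct_mem_multSubmodule (by simp [vanishAt]) c
  have hb : b ∈ multSubmodule φ univ := by rw [multSubmodule_univ]; trivial
  exact this hb

theorem norm_multGerm_le_norm_multAct {u : X} {f : C₀(X, ℂ)} (hf : f u = 1) (b : B) :
    ‖multGerm φ u b‖ ≤ ‖multAct φ f b‖ := by
  have : multGerm φ u b = multGerm φ u (multAct φ f b) := by
    rw [multGerm_multAct, hf, one_smul]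
  rw [this]
  exact norm_multGerm_le u _

variable [T2Space X] [LocallyCompactSpace X]

variable (φ) in
noncomputable instance instMultFiberNonUnitalCStarAlgebra (u : X) :
    NonUnitalCStarAlgebra (MultFiber φ u) :=
  { instMultFiberNonUnitalNormedRing φ u, instMultFiberNormedSpace φ u,
    instMultFiberCompleteSpace φ u, instMultFiberStar φ u with
    star_involutive := fun a => by
      obtain ⟨a, rfl⟩ := multGerm_surjective u a
      exact congrArg (multGerm φ u) (star_star a)
    star_mul := fun a b => by
      obtain ⟨a, rfl⟩ := multGerm_surjective u a
      obtain ⟨b, rfl⟩ := multGerm_surjective u b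
      exact congrArg (multGerm φ u) (star_mul a b)
    star_add := fun a b => by
      obtain ⟨a, rfl⟩ := multGerm_surjective u a
      obtain ⟨b, rfl⟩ := multGerm_surjective u b
      exact congrArg (multGerm φ u) (star_add a b)
    smul_assoc := fun c a b => by
      obtain ⟨a, rfl⟩ := multGerm_surjective u a
      obtain ⟨b, rfl⟩ := multGerm_surjective u b
      exact congrArg (multGerm φ u) (smul_mul_assoc c a b)
    smul_comm := fun c a b => by
      obtain ⟨a, rfl⟩ := multGerm_surjective u a
      obtain ⟨b, rfl⟩ := multGerm_surjective u b
      exact congrArg (multGerm φ u) (mul_smul_comm c a b).symm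
    star_smul := fun c a => by
      obtain ⟨a, rfl⟩ := multGerm_surjective u a
      exact congrArg (multGerm φ u) (star_smul c a)
    norm_mul_self_le := fun a => by
      obtain ⟨a, rfl⟩ := multGerm_surjective u a
      refine le_of_forall_gt_imp_ge_of_dense fun c hc => ?_
      obtain ⟨f, hf1, hfu, hfc⟩ := exists_norm_multAct_lt (b := star a * a) hc
      have h1 := norm_multGerm_le_norm_multAct (φ := φ) hfu.self_of_nhds a
      have h2 : star (multAct φ f a) * multAct φ f a
          = multAct φ (star f) (multAct φ f (star a * a)) := by
        rw [star_multAct, ← multAct_mul, ← multAct_mul_eq_mul_multAct,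
            multAct_mul_eq_mul_multAct φ f]
      calc ‖multGerm φ u a‖ * ‖multGerm φ u a‖
          ≤ ‖multAct φ f a‖ * ‖multAct φ f a‖ := by gcongr
        _ = ‖star (multAct φ f a) * multAct φ f a‖ := CStarRing.norm_star_mul_self.symm
        _ = ‖multAct φ (star f) (multAct φ f (star a * a))‖ := by rw [h2]
        _ ≤ ‖multAct φ f (star a * a)‖ :=
            (norm_multAct_le φ _ _).trans
              (mul_le_of_le_one_left (norm_nonneg _) ((norm_star f).trans_le hf1))
        _ ≤ c := hfc.le }

end Norm

/-! ### The norm of `B` is the supremum of the norms in the fibres -/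

section Isometry
variable {X : Type*} [TopologicalSpace X] {B : Type*} [NonUnitalCStarAlgebra B]
  {φ : C₀(X, ℂ) →⋆ₙₐ[ℂ] CentralMult B}

theorem coe_multAct (f : C₀(X, ℂ)) (b : B) :
    ((multAct φ f b : B) : 𝓜(ℂ, B)) = (φ f : 𝓜(ℂ, B)) * (b : 𝓜(ℂ, B)) := by
  refine DoubleCentralizer.ext ℂ B _ _ (Prod.ext ?_ ?_)
  · refine ContinuousLinearMap.ext fun x => ?_
    exact (multAct_mul φ f b x).symm
  · refine ContinuousLinearMap.ext fun x => ?_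
    exact ((φ f : 𝓜(ℂ, B)).central x b).symm

theorem norm_doubleCentralizer_coe (b : B) : ‖(b : 𝓜(ℂ, B))‖ = ‖b‖ := by
  rw [← DoubleCentralizer.norm_fst, DoubleCentralizer.coe_fst]
  exact ContinuousLinearMap.opNorm_mul_apply ℂ B b

theorem le_of_forall_pow_two_pow_le {x c C : ℝ} (hc : 0 < c)
    (h : ∀ k : ℕ, x ^ 2 ^ k ≤ C * c ^ 2 ^ k) : x ≤ c := by
  by_contra! hx
  have h1 : 1 < x / c := (one_lt_div hc).2 hx
  have hlim : Tendsto (fun k : ℕ => (x / c) ^ 2 ^ k) atTop atTop :=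
    (tendsto_pow_atTop_atTop_of_one_lt h1).comp
      (tendsto_pow_atTop_atTop_of_one_lt one_lt_two)
  obtain ⟨k, hk⟩ := (hlim.eventually_gt_atTop C).exists
  rw [div_pow, lt_div_iff₀ (pow_pos hc _)] at hk
  exact hk.not_ge (h k)

/-- The triangle inequality alone gives the bound `n * c`. Applied to the powers `b ^ 2 ^ k` of the
selfadjoint element `b`, it gives `n * c ^ 2 ^ k`, and the factor `n` disappears on taking roots. -/
theorem norm_multAct_sum_le {n : ℕ} {h f : Fin n → C₀(X, ℂ)} {b : B} {c : ℝ} (hc : 0 < c)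
    (hb : IsSelfAdjoint b) (hreal : ∀ i y, h i y = (‖h i y‖ : ℂ)) (hle : ∀ y, ∑ i, ‖h i y‖ ≤ 1)
    (hf : ∀ i y, h i y ≠ 0 → f i y = 1) (hfb : ∀ i, ‖multAct φ (f i) b‖ ≤ c) :
    ‖multAct φ (∑ i, h i) b‖ ≤ c := by
  have hg1 : ‖∑ i, h i‖ ≤ 1 := by
    rw [← ZeroAtInftyContinuousMap.norm_toBCF_eq_norm]
    refine (BoundedContinuousFunction.norm_le zero_le_one).2 fun y => ?_
    change ‖(∑ i, h i) y‖ ≤ 1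
    rw [ZeroAtInftyContinuousMap.finset_sum_apply]
    exact (norm_sum_le _ _).trans (hle y)
  have hh1 : ∀ i, ‖h i‖ ≤ 1 := fun i => by
    rw [← ZeroAtInftyContinuousMap.norm_toBCF_eq_norm]
    refine (BoundedContinuousFunction.norm_le zero_le_one).2 fun y => ?_
    exact (Finset.single_le_sum (f := fun i => ‖h i y‖) (fun _ _ => norm_nonneg _)
      (Finset.mem_univ i)).trans (hle y)
  have hstar : ∀ i, star (h i) = h i := fun i => by
    ext y
    rw [ZeroAtInftyContinuousMap.star_apply, hreal i y]
    exact Complex.conj_ofReal _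
  have hsa : IsSelfAdjoint (multAct φ (∑ i, h i) b) := by
    rw [IsSelfAdjoint, star_multAct, star_sum, hb.star_eq]
    simp only [hstar]
  let T : C₀(X, ℂ) → 𝓜(ℂ, B) := fun g => (φ g : 𝓜(ℂ, B))
  have hTle : ∀ g : C₀(X, ℂ), ‖g‖ ≤ 1 → ‖T g‖ ≤ 1 := fun g hg =>
    (norm_centralMult_le φ g).trans hg
  have hT : ∀ g m, (T g * (b : 𝓜(ℂ, B))) ^ m = T g ^ m * (b : 𝓜(ℂ, B)) ^ m := fun g m =>
    Commute.mul_pow (centralMult_mul_coe_comm φ g b) m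
  have hTm : ∀ i m, T (h i) * T (f i) ^ m = T (h i) := fun i m => by
    have h1 : h i * f i = h i := by
      ext y
      by_cases hy : h i y = 0
      · simp [hy]
      · simp [hf i y hy]
    have h2 : T (h i) * T (f i) = T (h i) := by
      have := congrArg T h1
      simpa [T] using this
    induction m with
    | zero => rw [pow_zero, mul_one]
    | succ m ih => rw [pow_succ, ← mul_assoc, ih, h2]
  have hTs : T (∑ i, h i) = ∑ i, T (h i) := by
    have : φ (∑ i, h i) = ∑ i, φ (h i) := map_sum φ _ _
    simp only [T, this]
    exact map_sum (NonUnitalStarSubalgebraClass.subtype (CentralMult B)) _ _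
  have hbound : ∀ m : ℕ, ‖(T (∑ i, h i) * (b : 𝓜(ℂ, B))) ^ (m + 1)‖ ≤ n * c ^ (m + 1) := by
    intro m
    have key : (T (∑ i, h i) * (b : 𝓜(ℂ, B))) ^ (m + 1) =
        ∑ i, T (∑ i, h i) ^ m * (T (h i) * (T (f i) * (b : 𝓜(ℂ, B))) ^ (m + 1)) := by
      have : ∀ i, T (h i) * (T (f i) * (b : 𝓜(ℂ, B))) ^ (m + 1) =
          T (h i) * (b : 𝓜(ℂ, B)) ^ (m + 1) := fun i => by rw [hT, ← mul_assoc, hTm]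
      simp only [this]
      rw [← Finset.mul_sum, ← Finset.sum_mul, ← hTs, hT, pow_succ, mul_assoc]
    have hcard : ∑ _i : Fin n, c ^ (m + 1) = n * c ^ (m + 1) := by simp
    rw [key, ← hcard]
    refine norm_sum_le_of_le _ fun i _ => ?_
    have h1 : ‖T (f i) * (b : 𝓜(ℂ, B))‖ ≤ c := by
      rw [← coe_multAct, norm_doubleCentralizer_coe]; exact hfb i
    have hcontr : ∀ g : C₀(X, ℂ), ‖g‖ ≤ 1 → ∀ y, ‖T g * y‖ ≤ ‖y‖ := fun g hg y =>
      (norm_mul_le _ _).trans (mul_le_of_le_one_left (norm_nonneg _) (hTle g hg))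
    have h2 : ∀ (k : ℕ) y, ‖T (∑ i, h i) ^ k * y‖ ≤ ‖y‖ := by
      intro k y
      induction k with
      | zero => rw [pow_zero, one_mul]
      | succ k ih =>
        rw [pow_succ', mul_assoc]
        exact (hcontr _ hg1 _).trans ih
    calc _ ≤ ‖T (h i) * (T (f i) * (b : 𝓜(ℂ, B))) ^ (m + 1)‖ := h2 _ _
      _ ≤ ‖(T (f i) * (b : 𝓜(ℂ, B))) ^ (m + 1)‖ := hcontr _ (hh1 i) _
      _ ≤ c ^ (m + 1) := (norm_pow_le' _ m.succ_pos).trans (by gcongr)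
  refine le_of_forall_pow_two_pow_le (C := n) hc fun k => ?_
  have hsaM : IsSelfAdjoint ((multAct φ (∑ i, h i) b : B) : 𝓜(ℂ, B)) :=
    hsa.map (DoubleCentralizer.coeHom (𝕜 := ℂ) (A := B))
  have hk := hsaM.norm_pow_two_pow k
  rw [norm_doubleCentralizer_coe, coe_multAct] at hk
  rw [← hk]
  obtain ⟨m, hm⟩ : ∃ m, 2 ^ k = m + 1 := ⟨2 ^ k - 1, (Nat.sub_add_cancel Nat.one_le_two_pow).symm⟩
  rw [hm]
  exact hbound m

variable [T2Space X] [LocallyCompactSpace X] [Fact (MultNondegenerate φ)]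

theorem eventually_norm_multGerm_lt {u : X} {b : B} {c : ℝ} (h : ‖multGerm φ u b‖ < c) :
    ∀ᶠ v in 𝓝 u, ‖multGerm φ v b‖ < c := by
  obtain ⟨f, -, hfu, hfc⟩ := exists_norm_multAct_lt h
  filter_upwards [hfu] with v hv
  exact (norm_multGerm_le_norm_multAct hv b).trans_lt hfc

theorem norm_le_of_forall_norm_multGerm_lt {b : B} (hb : IsSelfAdjoint b) {c : ℝ} (hc : 0 < c)
    (h : ∀ u, ‖multGerm φ u b‖ < c) : ‖b‖ ≤ c := by
  refine le_of_forall_pos_le_add fun ε hε => ?_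
  obtain ⟨t, ht, htg⟩ := exists_isCompact_norm_multAct_sub_le (φ := φ) b hε
  choose f _ hfu hfc using fun u => exists_norm_multAct_lt (h u)
  obtain ⟨n, p, g, -, hpos, hsupp, hle, h1⟩ :=
    exists_zeroAtInfty_partition ht (U := fun u => {y | f u y = 1}) fun u _ => hfu u
  have h2 := norm_multAct_sum_le (φ := φ) (f := fun i => f (p i)) hc hb hpos hle hsupp
    fun i => (hfc (p i)).le
  have h3 := htg (∑ i, g i)
    (fun y => by
      rw [ZeroAtInftyContinuousMap.finset_sum_apply]
      exact (norm_sum_le _ _).trans (hle y))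
    (fun y hy => by rw [ZeroAtInftyContinuousMap.finset_sum_apply, h1 y hy])
  have := norm_le_norm_add_norm_sub (multAct φ (∑ i, g i) b) b
  linarith

theorem norm_le_of_forall_norm_multGerm_le {b : B} {c : ℝ} (hc : 0 ≤ c)
    (h : ∀ u, ‖multGerm φ u b‖ ≤ c) : ‖b‖ ≤ c := by
  have h1 : ‖star b * b‖ ≤ c ^ 2 := le_of_forall_pos_le_add fun ε hε =>
    norm_le_of_forall_norm_multGerm_lt (φ := φ) (IsSelfAdjoint.star_mul_self b) (by positivity)
      fun u => by
        rw [multGerm_mul, multGerm_star, CStarRing.norm_star_mul_self]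
        nlinarith [h u, norm_nonneg (multGerm φ u b)]
  rw [CStarRing.norm_star_mul_self, ← pow_two] at h1
  exact le_of_sq_le_sq h1 hc

theorem tendsto_norm_multGerm_cocompact (b : B) :
    Tendsto (fun u => ‖multGerm φ u b‖) (cocompact X) (𝓝 0) := by
  refine (tendsto_order.2 ⟨fun a ha => Eventually.of_forall fun u =>
    ha.trans_le (norm_nonneg _), fun ε hε => ?_⟩)
  obtain ⟨t, ht, htg⟩ := exists_isCompact_norm_multAct_sub_le (φ := φ) b (half_pos hε)
  obtain ⟨g, -, hg1, -, hgt⟩ := exists_zeroAtInfty_bump_of_isCompact ht isOpen_univ (subset_univ t)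
  have hlim : Tendsto (fun u => ‖g u‖ * ‖b‖) (cocompact X) (𝓝 0) := by
    simpa using g.zero_at_infty'.norm.mul_const ‖b‖
  filter_upwards [hlim.eventually (gt_mem_nhds (half_pos hε))] with u hu
  have h1 : ‖multGerm φ u (multAct φ g b - b)‖ ≤ ε / 2 :=
    (norm_multGerm_le u _).trans (htg g hg1 hgt)
  rw [multGerm_sub, multGerm_multAct] at h1
  have h2 : ‖g u • multGerm φ u b‖ ≤ ‖g u‖ * ‖b‖ := by
    rw [norm_smul]
    gcongr
    exact norm_multGerm_le u b
  have := norm_le_norm_add_norm_sub (g u • multGerm φ u b) (multGerm φ u b)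
  linarith

/-- Gluing by a partition of unity: a family `σ` of germs that is small off a compact set `t`, and
near every point of `t` close to the germs of an element of `B`, is close to the germs of a single
element of `B`. -/
theorem exists_norm_multGerm_sum_sub_le {σ : ∀ v, MultFiber φ v} {t : Set X} (ht : IsCompact t)
    {ε : ℝ} (hσ : ∀ v ∉ t, ‖σ v‖ ≤ ε) {b : X → B} {U : X → Set X} (hU : ∀ x ∈ t, U x ∈ 𝓝 x)
    (hb : ∀ x ∈ t, ∀ v ∈ U x, ‖multGerm φ v (b x) - σ v‖ ≤ ε) :
    ∃ (n : ℕ) (p : Fin n → X) (h : Fin n → C₀(X, ℂ)), (∀ i, p i ∈ t) ∧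
      (∀ i y, h i y ≠ 0 → y ∈ U (p i)) ∧
      ∀ v, ‖multGerm φ v (∑ i, multAct φ (h i) (b (p i))) - σ v‖ ≤ ε := by
  obtain ⟨n, p, h, hp, hpos, hsupp, hle, h1⟩ := exists_zeroAtInfty_partition ht hU
  refine ⟨n, p, h, hp, hsupp, fun v => ?_⟩
  have hsum : (∑ i, h i v : ℂ) = ((∑ i, ‖h i v‖ : ℝ) : ℂ) := by
    rw [Complex.ofReal_sum]
    exact Finset.sum_congr rfl fun i _ => hpos i v
  have hsplit : multGerm φ v (∑ i, multAct φ (h i) (b (p i))) - σ v =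
      (∑ i, h i v • (multGerm φ v (b (p i)) - σ v)) - (1 - ∑ i, h i v) • σ v := by
    rw [multGerm_sum, sub_smul, one_smul, Finset.sum_smul]
    simp only [multGerm_multAct, smul_sub, Finset.sum_sub_distrib]
    abel
  have hfirst : ‖∑ i, h i v • (multGerm φ v (b (p i)) - σ v)‖ ≤ (∑ i, ‖h i v‖) * ε := by
    rw [Finset.sum_mul]
    refine norm_sum_le_of_le _ fun i _ => ?_
    rw [norm_smul]
    by_cases hv : h i v = 0
    · simp [hv]
    · gcongr
      exact hb _ (hp i) v (hsupp i v hv)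
  have hsecond : ‖(1 - ∑ i, h i v) • σ v‖ ≤ (1 - ∑ i, ‖h i v‖) * ε := by
    have h0 : 0 ≤ 1 - ∑ i, ‖h i v‖ := sub_nonneg.2 (hle v)
    by_cases hv : v ∈ t
    · have hs := h1 v hv
      have hs' : ∑ i, ‖h i v‖ = 1 := by
        rw [hsum] at hs
        exact_mod_cast hs
      rw [hs, hs']
      simp
    · rw [norm_smul, hsum, ← Complex.ofReal_one, ← Complex.ofReal_sub, Complex.norm_real,
        Real.norm_of_nonneg h0]
      gcongr
      exact hσ v hv
  rw [hsplit]
  refine (norm_sub_le _ _).trans ?_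
  linarith

end Isometry

/-! ### The bundle of fibres and its sections -/

section Bundle
variable {X : Type v} [TopologicalSpace X] {B : Type u} [NonUnitalCStarAlgebra B]
  (φ : C₀(X, ℂ) →⋆ₙₐ[ℂ] CentralMult B)

/-- The topology on the disjoint union of the fibres for which the tubes of small radius around
the sections `u ↦ multGerm φ u b` are neighbourhoods. -/
instance instMultFiberTopology : TopologicalSpace (BundleTotal (MultFiber φ)) where
  IsOpen O := ∀ (b : B) (u : X), ⟨u, multGerm φ u b⟩ ∈ O → ∃ ε > 0, ∀ᶠ v in 𝓝 u,
    ∀ a : MultFiber φ v, ‖a - multGerm φ v b‖ < ε → ⟨v, a⟩ ∈ O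
  isOpen_univ := fun _ _ _ => ⟨1, one_pos, Eventually.of_forall fun _ _ _ => mem_univ _⟩
  isOpen_inter := fun O O' hO hO' b u hu => by
    obtain ⟨ε, hε, h⟩ := hO b u hu.1
    obtain ⟨ε', hε', h'⟩ := hO' b u hu.2
    refine ⟨min ε ε', lt_min hε hε', ?_⟩
    filter_upwards [h, h'] with v hv hv' a ha
    exact ⟨hv a (ha.trans_le (min_le_left _ _)), hv' a (ha.trans_le (min_le_right _ _))⟩
  isOpen_sUnion := fun 𝒪 h𝒪 b u ⟨O, hO, hu⟩ => by
    obtain ⟨ε, hε, h⟩ := h𝒪 O hO b u hu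
    refine ⟨ε, hε, ?_⟩
    filter_upwards [h] with v hv a ha using ⟨O, hO, hv a ha⟩

variable {φ}
variable [T2Space X] [LocallyCompactSpace X] [Fact (MultNondegenerate φ)]

theorem isOpen_multTube (b : B) (ε : ℝ) {U : Set X} (hU : IsOpen U) :
    IsOpen {a : BundleTotal (MultFiber φ) | a.base ∈ U ∧ ‖a.val - multGerm φ a.base b‖ < ε} := by
  rintro c u ⟨huU : u ∈ U, hu : ‖multGerm φ u c - multGerm φ u b‖ < ε⟩
  obtain ⟨δ, hδ, hδε⟩ := exists_between hu
  refine ⟨ε - δ, sub_pos.2 hδε, ?_⟩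
  rw [← multGerm_sub] at hδ
  filter_upwards [hU.mem_nhds huU, eventually_norm_multGerm_lt hδ] with v hvU hv a ha
  refine ⟨hvU, ?_⟩
  rw [multGerm_sub] at hv
  have := norm_sub_le_norm_sub_add_norm_sub a (multGerm φ v c) (multGerm φ v b)
  change ‖a - multGerm φ v b‖ < ε
  linarith

/-- Convergence in the total space to a point on the section given by `b`. -/
theorem tendsto_nhds_multGerm {ι : Type*} {l : Filter ι} {F : ι → BundleTotal (MultFiber φ)}
    {u : X} {b : B} :
    Tendsto F l (𝓝 ⟨u, multGerm φ u b⟩) ↔ Tendsto (fun i => (F i).base) l (𝓝 u) ∧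
      Tendsto (fun i => ‖(F i).val - multGerm φ (F i).base b‖) l (𝓝 0) := by
  constructor
  · refine fun h => ⟨fun U hU => ?_, ?_⟩
    · obtain ⟨V, hVU, hV, huV⟩ := mem_nhds_iff.1 hU
      have hO := (isOpen_multTube (φ := φ) b 1 hV).mem_nhds (x := ⟨u, multGerm φ u b⟩)
        ⟨huV, by simp⟩
      change ∀ᶠ i in l, (F i).base ∈ U
      filter_upwards [h.eventually hO] with i hi using hVU hi.1
    · refine tendsto_order.2 ⟨fun a ha => Eventually.of_forall fun i =>
        ha.trans_le (norm_nonneg _), fun ε hε => ?_⟩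
      have hO := (isOpen_multTube (φ := φ) b ε isOpen_univ).mem_nhds (x := ⟨u, multGerm φ u b⟩)
        ⟨mem_univ _, by simpa using hε⟩
      filter_upwards [h.eventually hO] with i hi using hi.2
  · rintro ⟨h1, h2⟩ N hN
    obtain ⟨O, hON, hO, huO⟩ := mem_nhds_iff.1 hN
    obtain ⟨ε, hε, h⟩ := hO b u huO
    change ∀ᶠ i in l, F i ∈ N
    filter_upwards [h1.eventually h, h2.eventually (gt_mem_nhds hε)] with i hi hi'
    exact hON (hi _ hi')

theorem continuous_multGerm (b : B) :
    Continuous fun u => (⟨u, multGerm φ u b⟩ : BundleTotal (MultFiber φ)) :=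
  continuous_iff_continuousAt.2 fun _ => tendsto_nhds_multGerm.2
    ⟨tendsto_id, by simp⟩

theorem tendsto_base_nhds (a : BundleTotal (MultFiber φ)) :
    Tendsto (fun a : BundleTotal (MultFiber φ) => a.base) (𝓝 a) (𝓝 a.base) := by
  obtain ⟨u, a⟩ := a
  obtain ⟨b, rfl⟩ := multGerm_surjective u a
  exact (tendsto_nhds_multGerm.1 tendsto_id).1

theorem tendsto_pair_nhds {u : X} (b c : B) :
    Tendsto (fun p : BundlePair (MultFiber φ) => p.base) (𝓝 ⟨u, multGerm φ u b, multGerm φ u c⟩)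
      (𝓝 u) ∧
    Tendsto (fun p : BundlePair (MultFiber φ) => ‖p.val₁ - multGerm φ p.base b‖)
      (𝓝 ⟨u, multGerm φ u b, multGerm φ u c⟩) (𝓝 0) ∧
    Tendsto (fun p : BundlePair (MultFiber φ) => ‖p.val₂ - multGerm φ p.base c‖)
      (𝓝 ⟨u, multGerm φ u b, multGerm φ u c⟩) (𝓝 0) := by
  have h : Continuous fun p : BundlePair (MultFiber φ) =>
      ((⟨p.base, p.val₁⟩, ⟨p.base, p.val₂⟩) :
        BundleTotal (MultFiber φ) × BundleTotal (MultFiber φ)) := continuous_induced_dom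
  have h1 := tendsto_nhds_multGerm.1
    (h.fst.tendsto (⟨u, multGerm φ u b, multGerm φ u c⟩ : BundlePair (MultFiber φ)))
  have h2 := tendsto_nhds_multGerm.1
    (h.snd.tendsto (⟨u, multGerm φ u b, multGerm φ u c⟩ : BundlePair (MultFiber φ)))
  exact ⟨h1.1, h1.2, h2.2⟩

variable (φ) in
/-- The upper semicontinuous C*-bundle with fibres `B / φ(I_u) B`. -/
noncomputable abbrev multBundle : USCCStarBundle.{u, v} X where
  Fiber := MultFiber φ
  continuous_proj := continuous_iff_continuousAt.2 tendsto_base_nhds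
  isOpenMap_proj := IsOpenMap.of_sections fun ⟨u, a⟩ => by
    obtain ⟨b, rfl⟩ := multGerm_surjective u a
    exact ⟨fun v => ⟨v, multGerm φ v b⟩, (continuous_multGerm b).continuousAt, rfl, fun _ => rfl⟩
  upperSemicontinuous_norm := by
    rintro ⟨u, a⟩ c (hc : ‖a‖ < c)
    obtain ⟨b, rfl⟩ := multGerm_surjective u a
    obtain ⟨δ, hδ, hδc⟩ := exists_between hc
    have h := tendsto_nhds_multGerm.1
      (tendsto_id (x := 𝓝 (⟨u, multGerm φ u b⟩ : BundleTotal (MultFiber φ))))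
    filter_upwards [h.1.eventually (eventually_norm_multGerm_lt hδ),
      h.2.eventually (gt_mem_nhds (sub_pos.2 hδc))] with p hp1 hp2
    change ‖multGerm φ p.base b‖ < δ at hp1
    change ‖p.val - multGerm φ p.base b‖ < c - δ at hp2
    have := norm_le_norm_add_norm_sub' p.val (multGerm φ p.base b)
    linarith
  continuous_add := by
    refine continuous_iff_continuousAt.2 fun ⟨u, a, a'⟩ => ?_
    obtain ⟨b, rfl⟩ := multGerm_surjective u a
    obtain ⟨c, rfl⟩ := multGerm_surjective u a'
    obtain ⟨h0, h1, h2⟩ := tendsto_pair_nhds (φ := φ) (u := u) b c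
    refine (tendsto_nhds_multGerm (b := b + c)).2 ⟨h0, squeeze_zero (fun _ => norm_nonneg _)
      (fun p => ?_) (by simpa using h1.add h2)⟩
    have : p.val₁ + p.val₂ - multGerm φ p.base (b + c) =
      (p.val₁ - multGerm φ p.base b) + (p.val₂ - multGerm φ p.base c) := by
      rw [multGerm_add]; abel
    rw [this]
    exact norm_add_le _ _
  continuous_mul := by
    refine continuous_iff_continuousAt.2 fun ⟨u, a, a'⟩ => ?_
    obtain ⟨b, rfl⟩ := multGerm_surjective u a
    obtain ⟨c, rfl⟩ := multGerm_surjective u a'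
    obtain ⟨h0, h1, h2⟩ := tendsto_pair_nhds (φ := φ) (u := u) b c
    have hlim := (h1.mul (h2.add_const ‖c‖)).add (h2.const_mul ‖b‖)
    refine (tendsto_nhds_multGerm (b := b * c)).2 ⟨h0, squeeze_zero (fun _ => norm_nonneg _)
      (fun p => ?_) (by simpa using hlim)⟩
    have : p.val₁ * p.val₂ - multGerm φ p.base (b * c) =
      (p.val₁ - multGerm φ p.base b) * ((p.val₂ - multGerm φ p.base c) + multGerm φ p.base c) +
        multGerm φ p.base b * (p.val₂ - multGerm φ p.base c) := by
      rw [multGerm_mul, sub_add_cancel, sub_mul, mul_sub]; abel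
    rw [this]
    refine (norm_add_le _ _).trans (add_le_add ((norm_mul_le _ _).trans ?_)
      ((norm_mul_le _ _).trans ?_))
    · gcongr
      exact (norm_add_le _ _).trans (by gcongr; exact norm_multGerm_le _ c)
    · gcongr
      exact norm_multGerm_le _ b
  continuous_smul := by
    refine continuous_iff_continuousAt.2 fun ⟨z, u, a⟩ => ?_
    obtain ⟨b, rfl⟩ := multGerm_surjective u a
    have h := tendsto_nhds_multGerm.1
      (continuous_snd.tendsto (z, (⟨u, multGerm φ u b⟩ : BundleTotal (MultFiber φ))))
    have hz := continuous_fst.tendsto (z, (⟨u, multGerm φ u b⟩ : BundleTotal (MultFiber φ)))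
    have hlim := (hz.norm.mul h.2).add ((hz.sub_const z).norm.mul_const ‖b‖)
    refine (tendsto_nhds_multGerm (b := z • b)).2 ⟨h.1, squeeze_zero (fun _ => norm_nonneg _)
      (fun p => ?_) (by simpa using hlim)⟩
    have : p.1 • p.2.val - multGerm φ p.2.base (z • b) =
        p.1 • (p.2.val - multGerm φ p.2.base b) + (p.1 - z) • multGerm φ p.2.base b := by
      rw [multGerm_smul, smul_sub, sub_smul]; abel
    rw [this]
    refine (norm_add_le _ _).trans ?_
    rw [norm_smul, norm_smul]
    gcongr
    exact norm_multGerm_le _ b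
  continuous_star := by
    refine continuous_iff_continuousAt.2 fun ⟨u, a⟩ => ?_
    obtain ⟨b, rfl⟩ := multGerm_surjective u a
    have h := tendsto_nhds_multGerm.1
      (tendsto_id (x := 𝓝 (⟨u, multGerm φ u b⟩ : BundleTotal (MultFiber φ))))
    refine (tendsto_nhds_multGerm (b := star b)).2 ⟨h.1, h.2.congr fun p => ?_⟩
    change _ = ‖star p.val - multGerm φ p.base (star b)‖
    rw [multGerm_star, ← star_sub, norm_star]
    rfl
  tendsto_zero := fun x l h0 h1 => by
    have : Tendsto id l (𝓝 (⟨x, multGerm φ x (0 : B)⟩ : BundleTotal (MultFiber φ))) :=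
      tendsto_nhds_multGerm.2 ⟨h0, by simpa [multGerm_zero] using h1⟩
    exact this

end Bundle

/-! ### The isomorphism with the algebra of sections -/

section Gelfand
variable {X : Type v} [TopologicalSpace X] {B : Type u} [NonUnitalCStarAlgebra B]
  {φ : C₀(X, ℂ) →⋆ₙₐ[ℂ] CentralMult B}
  [T2Space X] [LocallyCompactSpace X] [Fact (MultNondegenerate φ)]

theorem isClosed_setOf_le_norm_multGerm (b : B) (ε : ℝ) :
    IsClosed {v | ε ≤ ‖multGerm φ v b‖} := by
  rw [← isOpen_compl_iff, isOpen_iff_mem_nhds]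
  intro v hv
  filter_upwards [eventually_norm_multGerm_lt (not_le.1 hv)] with w hw using not_le.2 hw

theorem isCompact_setOf_le_norm_multGerm (b : B) {ε : ℝ} (hε : 0 < ε) :
    IsCompact {v | ε ≤ ‖multGerm φ v b‖} := by
  obtain ⟨t, ht, hts⟩ := mem_cocompact.1
    ((tendsto_norm_multGerm_cocompact (φ := φ) b).eventually (gt_mem_nhds hε))
  refine ht.of_isClosed_subset (isClosed_setOf_le_norm_multGerm b ε) fun v hv => ?_
  by_contra hvt
  have hlt : ‖multGerm φ v b‖ < ε := hts hvt
  exact hlt.not_ge hv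

/-- Every continuous section vanishing at infinity is uniformly approximated by elements of `B`. -/
theorem exists_norm_multGerm_sub_le (σ : (multBundle φ).Gamma0) {ε : ℝ} (hε : 0 < ε) :
    ∃ b : B, ∀ v, ‖multGerm φ v b - σ.1 v‖ ≤ ε := by
  obtain ⟨hcont, hlim⟩ := σ.2
  obtain ⟨t, ht, hts⟩ := mem_cocompact.1 (hlim.eventually (gt_mem_nhds hε))
  choose b hb using fun x => multGerm_surjective x (σ.1 x)
  have hnear : ∀ x, ∀ᶠ v in 𝓝 x, ‖multGerm φ v (b x) - σ.1 v‖ < ε := fun x => by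
    have h := hcont.tendsto x
    rw [← hb x] at h
    have h2 := (tendsto_nhds_multGerm.1 h).2
    filter_upwards [h2.eventually (gt_mem_nhds hε)] with v hv
    rw [norm_sub_rev]
    exact hv
  obtain ⟨n, p, h, -, -, hv⟩ := exists_norm_multGerm_sum_sub_le (φ := φ) (σ := σ.1) ht
    (fun v hv => (hts hv).le) (b := b) (fun x _ => hnear x) fun x _ v hv => le_of_lt hv
  exact ⟨_, hv⟩

variable (φ) in
/-- The homomorphism from `B` to the continuous sections of its bundle of fibres. -/
noncomputable def multSectionHom : B →⋆ₙₐ[ℂ] (multBundle φ).Gamma0 where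
  toFun b := ⟨fun u => multGerm φ u b, continuous_multGerm b, tendsto_norm_multGerm_cocompact b⟩
  map_smul' _ _ := rfl
  map_zero' := rfl
  map_add' _ _ := rfl
  map_mul' _ _ := rfl
  map_star' _ := rfl

theorem eq_of_forall_multGerm_eq {a b : B} (h : ∀ u, multGerm φ u a = multGerm φ u b) :
    a = b := by
  rw [← sub_eq_zero, ← norm_le_zero_iff]
  exact norm_le_of_forall_norm_multGerm_le (φ := φ) le_rfl fun u => by
    rw [multGerm_sub, h u, sub_self, norm_zero]

theorem multSectionHom_surjective : Function.Surjective (multSectionHom φ) := by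
  intro σ
  choose b hb using fun n : ℕ =>
    exists_norm_multGerm_sub_le σ (ε := 1 / ((n : ℝ) + 1)) Nat.one_div_pos_of_nat
  have hdist : ∀ N : ℕ, ∀ n ≥ N, ∀ v, ‖multGerm φ v (b n) - σ.1 v‖ ≤ 1 / ((N : ℝ) + 1) :=
    fun N n hn v => (hb n v).trans (Nat.one_div_le_one_div hn)
  have hcauchy : CauchySeq b := by
    refine cauchySeq_of_le_tendsto_0 (fun N : ℕ => 1 / ((N : ℝ) + 1) + 1 / ((N : ℝ) + 1))
      (fun n m N hn hm => ?_) ?_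
    · rw [dist_eq_norm]
      refine norm_le_of_forall_norm_multGerm_le (φ := φ) (by positivity) fun v => ?_
      have := norm_sub_le_norm_sub_add_norm_sub (multGerm φ v (b n)) (σ.1 v) (multGerm φ v (b m))
      rw [norm_sub_rev (σ.1 v)] at this
      rw [multGerm_sub]
      linarith [hdist N n hn v, hdist N m hm v]
    · simpa using tendsto_one_div_add_atTop_nhds_zero_nat.add
        (tendsto_one_div_add_atTop_nhds_zero_nat (𝕜 := ℝ))
  obtain ⟨a, ha⟩ := cauchySeq_tendsto_of_complete hcauchy
  refine ⟨a, Subtype.ext (funext fun v => ?_)⟩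
  change multGerm φ v a = σ.1 v
  have h1 : Tendsto (fun n => multGerm φ v (b n)) atTop (𝓝 (multGerm φ v a)) := by
    rw [tendsto_iff_norm_sub_tendsto_zero] at ha ⊢
    exact squeeze_zero (fun _ => norm_nonneg _) (fun n => norm_multGerm_le v (b n - a)) ha
  have h2 : Tendsto (fun n => multGerm φ v (b n)) atTop (𝓝 (σ.1 v)) := by
    rw [tendsto_iff_norm_sub_tendsto_zero]
    exact squeeze_zero (fun _ => norm_nonneg _) (fun n => hb n v)
      tendsto_one_div_add_atTop_nhds_zero_nat
  exact tendsto_nhds_unique h1 h2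

variable (φ) in
/-- `B` is isomorphic to the algebra of continuous sections vanishing at infinity. -/
noncomputable def multSectionEquiv : B ≃⋆ₐ[ℂ] (multBundle φ).Gamma0 :=
  StarAlgEquiv.ofBijective (multSectionHom φ)
    ⟨fun _ _ h => eq_of_forall_multGerm_eq (φ := φ) fun u => congrFun (congrArg Subtype.val h) u,
      multSectionHom_surjective⟩

end Gelfand

/-! ### Units and local bisections of an `r`-discrete groupoid -/

namespace TopGroupoid
variable {G : Type v} [TopologicalSpace G] [TopGroupoid G]

/-- Near a unit `u`, both `y` and `d(y)` lie in a set on which `d` is injective, and `d(d(y)) = d(y)`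
forces `y = d(y)`. -/
theorem isOpen_units [IsRDiscrete G] : IsOpen (units G) := by
  rw [isOpen_iff_mem_nhds]
  intro u hu
  have hloc : IsLocalHomeomorph (d : G → units G) := IsRDiscrete.isLocalHomeomorph_d
  have hcont : Continuous (dom : G → G) := continuous_subtype_val.comp hloc.continuous
  obtain ⟨e, hue, he⟩ := hloc u
  have hdu : dom u ∈ e.source := by rwa [show dom u = u from hu]
  filter_upwards [e.open_source.mem_nhds hue,
    hcont.continuousAt.preimage_mem_nhds (e.open_source.mem_nhds hdu)] with y hy hdy
  refine e.injOn hdy hy ?_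
  rw [← he]
  exact d_unit (d y)

variable {S : InverseSubsemigroup G}

namespace InverseSubsemigroup

theorem coe_star_mul_self (s : S.Elem) : ((star s * s : S.Elem) : Set G) = dom '' (s : Set G) := by
  have hs := S.isOpenGSet _ s.2
  ext z
  constructor
  · rintro ⟨_, ⟨x, hx, rfl⟩, y, hy, hxy, rfl⟩
    have h : ran x = ran y := (dom_ginv x).symm.trans (congrArg Subtype.val hxy)
    obtain rfl := hs.2.1 hx hy (Subtype.ext h)
    exact ⟨x, hx, (ginv_gmul x).symm⟩
  · rintro ⟨x, hx, rfl⟩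
    exact ⟨ginv x, ⟨x, hx, rfl⟩, x, hx, Subtype.ext (dom_ginv x), (ginv_gmul x).symm⟩

theorem coe_mul_star_self (s : S.Elem) : ((s * star s : S.Elem) : Set G) = ran '' (s : Set G) := by
  have hs := S.isOpenGSet _ s.2
  ext z
  constructor
  · rintro ⟨y, hy, _, ⟨x, hx, rfl⟩, hxy, rfl⟩
    have h : dom y = dom x := (congrArg Subtype.val hxy).trans (ran_ginv x)
    obtain rfl := hs.2.2 hx hy (Subtype.ext h.symm)
    exact ⟨x, hx, (gmul_ginv x).symm⟩
  · rintro ⟨x, hx, rfl⟩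
    exact ⟨x, hx, ginv x, ⟨x, hx, rfl⟩, Subtype.ext (ran_ginv x).symm, (gmul_ginv x).symm⟩

theorem isIdempotentElem_of_subset_units {e : S.Elem} (he : (e : Set G) ⊆ units G) :
    IsIdempotentElem e := by
  have hself : ∀ u ∈ (e : Set G), gmul u u = u := fun u hu => by
    have h : dom u = u := he hu
    have := gmul_dom u
    rwa [h] at this
  refine Subtype.ext (Set.ext fun z => ⟨?_, fun hz => ?_⟩)
  · rintro ⟨x, hx, y, hy, hxy, rfl⟩
    have h : x = y := by
      rw [← show (d x : G) = x from he hx, hxy]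
      exact congrArg Subtype.val (r_unit ⟨y, he hy⟩)
    subst h
    rwa [hself x hx]
  · have h : d z = r z := by
      rw [show d z = ⟨z, he hz⟩ from d_unit ⟨z, he hz⟩, show r z = ⟨z, he hz⟩ from r_unit ⟨z, he hz⟩]
    exact ⟨z, hz, z, hz, h, (hself z hz).symm⟩

theorem isIdempotentElem_star_mul_self (s : S.Elem) : IsIdempotentElem (star s * s) :=
  isIdempotentElem_of_subset_units (by
    rw [coe_star_mul_self]
    rintro _ ⟨x, -, rfl⟩
    exact dom_dom x)

/-- An element `t ⊆ s` is the restriction of `s` to the idempotent `d(t)`. -/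
theorem mul_star_mul_self_of_subset {s t : S.Elem} (h : (t : Set G) ⊆ s) :
    s * (star t * t) = t := by
  have hs := S.isOpenGSet _ s.2
  refine Subtype.ext (Set.ext fun z => ⟨?_, fun hz => ?_⟩)
  · rintro ⟨x, hx, y, hy, hxy, rfl⟩
    rw [coe_star_mul_self] at hy
    obtain ⟨w, hw, rfl⟩ := hy
    have hdx : dom x = dom w := (congrArg Subtype.val hxy).trans (ran_dom w)
    obtain rfl := hs.2.2 hx (h hw) (Subtype.ext hdx)
    rwa [gmul_dom]
  · refine ⟨z, h hz, dom z, ?_, Subtype.ext (ran_dom z).symm, (gmul_dom z).symm⟩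
    rw [coe_star_mul_self]
    exact ⟨z, hz, rfl⟩

theorem mul_star_self_mul (t : S.Elem) : t * star t * t = t := by
  have ht := S.isOpenGSet _ t.2
  refine Subtype.ext (Set.ext fun z => ⟨?_, fun hz => ?_⟩)
  · rintro ⟨x, hx, y, hy, hxy, rfl⟩
    rw [coe_mul_star_self] at hx
    obtain ⟨w, hw, rfl⟩ := hx
    have hwy : ran w = ran y := (dom_ran w).symm.trans (congrArg Subtype.val hxy)
    rwa [hwy, ran_gmul_self]
  · refine ⟨ran z, ?_, z, hz, Subtype.ext (dom_ran z), (ran_gmul_self z).symm⟩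
    rw [coe_mul_star_self]
    exact ⟨z, hz, rfl⟩

theorem IsFull.exists_mem_subset (hS : S.IsFull) {x : G} {O : Set G} (hO : IsOpen O) (hx : x ∈ O) :
    ∃ s : S.Elem, x ∈ (s : Set G) ∧ (s : Set G) ⊆ O := by
  obtain ⟨s, hs, hxs, hsO⟩ := hS.1.exists_subset_of_mem_open hx hO
  exact ⟨⟨s, hs⟩, hxs, hsO⟩

end InverseSubsemigroup
end TopGroupoid

/-! ### Actions by partial automorphisms -/

/-- The domain of a partial automorphism is a C*-algebra once it is known to be stable under `star`,
so the partial automorphism is contractive. -/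
theorem PartialAut.norm_apply_le {B : Type*} [NonUnitalCStarAlgebra B] (θ : PartialAut B)
    (hstar : ∀ a ∈ θ.source, star a ∈ θ.source) {a : B} (ha : a ∈ θ.source) :
    ‖θ.toPartialEquiv a‖ ≤ ‖a‖ := by
  let I : NonUnitalStarSubalgebra ℂ B :=
    { carrier := θ.source
      add_mem' := fun {a b} ha hb => θ.source_ideal.add_mem a ha b hb
      zero_mem' := θ.source_ideal.zero_mem
      mul_mem' := fun {a b} _ hb => θ.source_ideal.mul_mem_left a b hb
      smul_mem' := fun c a ha => θ.source_ideal.smul_mem c a ha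
      star_mem' := fun {a} ha => hstar a ha }
  have : IsClosed (I : Set B) := θ.source_ideal.isClosed
  let f : I →⋆ₙₐ[ℂ] B :=
    { toFun := fun a => θ.toPartialEquiv a.1
      map_smul' := fun c a => θ.map_smul c a.1 a.2
      map_zero' := by simpa using θ.map_smul 0 0 θ.source_ideal.zero_mem
      map_add' := fun a b => θ.map_add a.1 a.2 b.1 b.2
      map_mul' := fun a b => θ.map_mul a.1 a.2 b.1 b.2
      map_star' := fun a => θ.map_star a.1 a.2 }
  exact NonUnitalStarAlgHom.norm_apply_le f ⟨a, ha⟩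

namespace InverseSemigroupAction

section Semigroup
variable {S : Type*} [Mul S] {B : Type*} [NonUnitalCStarAlgebra B]
  (β : InverseSemigroupAction S B)

theorem mem_ideal_mul {s t : S} {b : B} :
    b ∈ β.ideal (s * t) ↔ b ∈ β.ideal t ∧ β.act t b ∈ β.ideal s := by
  rw [ideal, (β.map_mul s t).1, PartialEquiv.trans_source]
  rfl

theorem act_mul {s t : S} {b : B} (hb : b ∈ β.ideal (s * t)) :
    β.act (s * t) b = β.act s (β.act t b) :=
  (β.map_mul s t).2 hb

theorem act_zero (s : S) : β.act s 0 = 0 := by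
  have := (β.toFun s).map_smul 0 0 (β.toFun s).source_ideal.zero_mem
  rwa [zero_smul, zero_smul] at this

theorem sub_mem_ideal {s : S} {a b : B} (ha : a ∈ β.ideal s) (hb : b ∈ β.ideal s) :
    a - b ∈ β.ideal s := by
  have := (β.toFun s).source_ideal.add_mem a ha _ ((β.toFun s).source_ideal.smul_mem (-1) b hb)
  rwa [neg_one_smul, ← sub_eq_add_neg] at this

theorem act_sub {s : S} {a b : B} (ha : a ∈ β.ideal s) (hb : b ∈ β.ideal s) :
    β.act s (a - b) = β.act s a - β.act s b := by
  have := (β.toFun s).map_add _ (β.sub_mem_ideal ha hb) b hb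
  rw [sub_add_cancel] at this
  exact eq_sub_of_add_eq this.symm

theorem act_of_isIdempotentElem {e : S} (he : IsIdempotentElem e) {b : B} (hb : b ∈ β.ideal e) :
    β.act e b = b := by
  have hee : b ∈ β.ideal (e * e) := by rwa [he.eq]
  have h1 := β.act_mul hee
  rw [he.eq] at h1
  exact (β.toFun e).injOn ((β.mem_ideal_mul).1 hee).2 hb h1.symm

end Semigroup

open TopGroupoid TopGroupoid.InverseSubsemigroup

variable {G : Type v} [TopologicalSpace G] [TopGroupoid G] {S : TopGroupoid.InverseSubsemigroup G}
  {B : Type u} [NonUnitalCStarAlgebra B] (β : InverseSemigroupAction S.Elem B)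

theorem act_of_subset {s t : S.Elem} (h : (t : Set G) ⊆ s) {b : B} (hb : b ∈ β.ideal t) :
    b ∈ β.ideal s ∧ β.act t b = β.act s b := by
  rw [← mul_star_mul_self_of_subset h] at hb
  have h1 := (β.mem_ideal_mul).1 hb
  have h2 := β.act_of_isIdempotentElem (isIdempotentElem_star_mul_self t) h1.1
  refine ⟨h2 ▸ h1.2, ?_⟩
  have h3 := β.act_mul hb
  rwa [mul_star_mul_self_of_subset h, h2] at h3

theorem ideal_star_mul_self (s : S.Elem) : β.ideal (star s * s) = β.ideal s := by
  refine Subset.antisymm (fun b hb => ((β.mem_ideal_mul).1 hb).1) fun b hb => ?_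
  rw [← mul_star_mul_self_of_subset (Subset.refl (s : Set G))] at hb
  exact ((β.mem_ideal_mul).1 hb).1

theorem act_mem_ideal_mul_star_self {s : S.Elem} {b : B} (hb : b ∈ β.ideal s) :
    β.act s b ∈ β.ideal (s * star s) := by
  rw [← mul_star_self_mul s] at hb
  exact ((β.mem_ideal_mul).1 hb).2

end InverseSemigroupAction

/-! ### Germs of the partial automorphisms -/

namespace InverseSemigroupAction
open TopGroupoid TopGroupoid.InverseSubsemigroup

variable {G : Type v} [TopologicalSpace G] [TopGroupoid G]
  {S : TopGroupoid.InverseSubsemigroup G}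
  {B : Type u} [NonUnitalCStarAlgebra B] {β : InverseSemigroupAction S.Elem B}
  {φ : C₀(units G, ℂ) →⋆ₙₐ[ℂ] CentralMult B}

/-- `φ(C_e) B = B_e` for all idempotents `e` of `S`. -/
def IsCompatible (β : InverseSemigroupAction S.Elem B)
    (φ : C₀(units G, ℂ) →⋆ₙₐ[ℂ] CentralMult B) : Prop :=
  ∀ e : S.Elem, IsIdempotentElem e → multIdeal φ (vanishOff (e : Set G)) = β.ideal e

namespace IsCompatible

theorem mem_ideal_iff (h : β.IsCompatible φ) {s : S.Elem} {b : B} :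
    b ∈ β.ideal s ↔ b ∈ multSubmodule φ (vanishOff (dom '' (s : Set G))) := by
  rw [← β.ideal_star_mul_self s, ← h _ (isIdempotentElem_star_mul_self s), coe_star_mul_self,
    mem_multSubmodule]

theorem multAct_mem_ideal (h : β.IsCompatible φ) {s : S.Elem} {f : C₀(units G, ℂ)}
    (hf : ∀ u : units G, f u ≠ 0 → (u : G) ∈ dom '' (s : Set G)) (b : B) :
    multAct φ f b ∈ β.ideal s :=
  h.mem_ideal_iff.2 (multAct_mem_multSubmodule (fun u hu => by
    by_contra hfu
    exact hu (hf u hfu)) b)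

theorem multGerm_eq_zero_of_mem_ideal (h : β.IsCompatible φ) {s : S.Elem} {b : B}
    (hb : b ∈ β.ideal s) {u : units G} (hu : (u : G) ∉ dom '' (s : Set G)) :
    multGerm φ u b = 0 :=
  multGerm_eq_zero_iff.2
    (multSubmodule_mono (J := vanishOff (dom '' (s : Set G))) (fun _ hf => hf u hu)
      (h.mem_ideal_iff.1 hb))

theorem multGerm_act_eq_zero (h : β.IsCompatible φ) {s : S.Elem} {b : B}
    (hb : b ∈ β.ideal s) {u : units G} (hu : (u : G) ∉ ran '' (s : Set G)) :
    multGerm φ u (β.act s b) = 0 := by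
  refine h.multGerm_eq_zero_of_mem_ideal (β.act_mem_ideal_mul_star_self hb) ?_
  rw [coe_mul_star_self]
  rintro ⟨_, ⟨x, hx, rfl⟩, hxu⟩
  exact hu ⟨x, hx, (dom_ran x).symm.trans hxu⟩

theorem star_mem_ideal (h : β.IsCompatible φ) {s : S.Elem} {b : B} (hb : b ∈ β.ideal s) :
    star b ∈ β.ideal s := by
  refine h.mem_ideal_iff.2 (star_mem_multSubmodule (fun f hf => ?_) (h.mem_ideal_iff.1 hb))
  intro u hu
  change star (f u) = 0
  rw [hf u hu, star_zero]

theorem norm_act_le (h : β.IsCompatible φ) {s : S.Elem} {b : B} (hb : b ∈ β.ideal s) :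
    ‖β.act s b‖ ≤ ‖b‖ := by
  exact (β.toFun s).norm_apply_le (fun _ => h.star_mem_ideal) hb

theorem isOpen_dom_image (s : S.Elem) : IsOpen (dom '' (s : Set G)) := by
  rw [← coe_star_mul_self]
  exact (S.isOpenGSet _ (star s * s).2).1

variable [IsRDiscrete G] [LocallyCompactSpace (units G)] [Fact (MultNondegenerate φ)]

/-- Every element of the fibre over `d(x)` is the germ of an element of `B_{d(s)}`, for `s ∋ x`. -/
theorem exists_mem_ideal_multGerm_eq (h : β.IsCompatible φ) {s : S.Elem} {x : G}
    (hx : x ∈ (s : Set G)) (a : MultFiber φ (d x)) :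
    ∃ b ∈ β.ideal s, multGerm φ (d x) b = a := by
  obtain ⟨b, rfl⟩ := multGerm_surjective _ a
  have hU : ((↑) : units G → G) ⁻¹' (dom '' (s : Set G)) ∈ 𝓝 (d x) :=
    ((isOpen_dom_image s).preimage continuous_subtype_val).mem_nhds ⟨x, hx, rfl⟩
  obtain ⟨f, -, hfU, hf1⟩ := exists_zeroAtInfty_bump hU
  exact ⟨multAct φ f b, h.multAct_mem_ideal hfU b, by
    rw [multGerm_multAct, hf1.self_of_nhds, one_smul]⟩

/-- `β_s` maps the part of `B_{d(s)}` lying in `φ(I_{d(x)}) B` into `φ(I_{r(x)}) B`. The points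
where the germ of `b` is large are of the form `d(y)` with `y ∈ s`, `y ≠ x`, so `b` is nearly a sum
of elements in the domains of `β_t` with `t ⊆ s \ {x}`; and `r(x)` is not in the range of such a
`t`. -/
theorem multGerm_act_eq_zero_of_multGerm_eq_zero (h : β.IsCompatible φ) (hS : S.IsFull)
    {s : S.Elem} {x : G} (hx : x ∈ (s : Set G)) {b : B} (hb : b ∈ β.ideal s)
    (hb0 : multGerm φ (d x) b = 0) : multGerm φ (r x) (β.act s b) = 0 := by
  have hs := S.isOpenGSet _ s.2
  have hlocal : ∀ v : units G, multGerm φ v b ≠ 0 →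
      ∃ t : S.Elem, (v : G) ∈ dom '' (t : Set G) ∧ (t : Set G) ⊆ (s : Set G) \ {x} := by
    intro v hv
    obtain ⟨y, hy, hyv⟩ : (v : G) ∈ dom '' (s : Set G) := by
      by_contra hvs
      exact hv (h.multGerm_eq_zero_of_mem_ideal hb hvs)
    have hyx : y ≠ x := by
      rintro rfl
      exact hv (by rwa [show v = d y from Subtype.ext hyv.symm])
    obtain ⟨t, hyt, hts⟩ := hS.exists_mem_subset (hs.1.sdiff isClosed_singleton) ⟨hy, hyx⟩
    exact ⟨t, ⟨y, hyt, hyv⟩, hts⟩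
  refine norm_le_zero_iff.1 (le_of_forall_pos_le_add fun ε hε => ?_)
  rw [zero_add]
  have : Nonempty S.Elem := ⟨s⟩
  choose! t htv hts using hlocal
  have hne : ∀ v ∈ {v | ε ≤ ‖multGerm φ v b‖}, multGerm φ v b ≠ 0 := fun v hv h0 => by
    have hv' : ε ≤ ‖multGerm φ v b‖ := hv
    rw [h0, norm_zero] at hv'
    exact hε.not_ge hv'
  obtain ⟨n, p, k, hp, hk, hclose⟩ := exists_norm_multGerm_sum_sub_le (φ := φ)
    (σ := fun v => multGerm φ v b) (isCompact_setOf_le_norm_multGerm (φ := φ) b hε) (ε := ε)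
    (fun v hv => (not_le.1 hv).le) (b := fun _ => b)
    (U := fun v => ((↑) : units G → G) ⁻¹' (dom '' (t v : Set G)))
    (fun v hv => ((isOpen_dom_image (t v)).preimage continuous_subtype_val).mem_nhds
      (htv v (hne v hv)))
    (fun v _ w _ => by simpa using hε.le)
  set c := ∑ i, multAct φ (k i) b
  have hbc : ‖c - b‖ ≤ ε := norm_le_of_forall_norm_multGerm_le (φ := φ) hε.le hclose
  have hc : c ∈ β.ideal s ∧ multGerm φ (r x) (β.act s c) = 0 := by
    refine Finset.sum_induction _
      (fun c => c ∈ β.ideal s ∧ multGerm φ (r x) (β.act s c) = 0) ?_ ?_ fun i _ => ?_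
    · rintro a a' ⟨ha, ha0⟩ ⟨ha', ha0'⟩
      refine ⟨(β.toFun s).source_ideal.add_mem a ha a' ha', ?_⟩
      rw [show β.act s (a + a') = β.act s a + β.act s a' from (β.toFun s).map_add a ha a' ha',
        multGerm_add, ha0, ha0', add_zero]
    · exact ⟨(β.toFun s).source_ideal.zero_mem, by rw [β.act_zero, multGerm_zero]⟩
    · have hti := hts (p i) (hne _ (hp i))
      have hmem : multAct φ (k i) b ∈ β.ideal (t (p i)) := h.multAct_mem_ideal (hk i) b
      obtain ⟨h1, h2⟩ := β.act_of_subset (fun y hy => (hti hy).1) hmem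
      refine ⟨h1, ?_⟩
      rw [← h2]
      refine h.multGerm_act_eq_zero hmem ?_
      rintro ⟨y, hy, hyx⟩
      exact (hti hy).2 (hs.2.1 (hti hy).1 hx (Subtype.ext hyx))
  have h3 : multGerm φ (r x) (β.act s b) = -multGerm φ (r x) (β.act s (c - b)) := by
    rw [β.act_sub hc.1 hb, multGerm_sub, hc.2, zero_sub, neg_neg]
  rw [h3, norm_neg]
  exact (norm_multGerm_le _ _).trans ((h.norm_act_le (β.sub_mem_ideal hc.1 hb)).trans hbc)

theorem multGerm_act_eq_of_multGerm_eq (h : β.IsCompatible φ) (hS : S.IsFull)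
    {s : S.Elem} {x : G} (hx : x ∈ (s : Set G)) {b c : B} (hb : b ∈ β.ideal s)
    (hc : c ∈ β.ideal s) (hbc : multGerm φ (d x) b = multGerm φ (d x) c) :
    multGerm φ (r x) (β.act s b) = multGerm φ (r x) (β.act s c) := by
  rw [← sub_eq_zero, ← multGerm_sub, ← β.act_sub hb hc]
  exact h.multGerm_act_eq_zero_of_multGerm_eq_zero hS hx (β.sub_mem_ideal hb hc)
    (by rw [multGerm_sub, hbc, sub_self])

/-- The germ of `β_s(b)` at `r(x)` depends only on `x` and on the germ of `b` at `d(x)`. -/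
theorem multGerm_act_eq (h : β.IsCompatible φ) (hS : S.IsFull)
    {s t : S.Elem} {x : G} (hxs : x ∈ (s : Set G)) (hxt : x ∈ (t : Set G)) {b c : B}
    (hb : b ∈ β.ideal s) (hc : c ∈ β.ideal t) (hbc : multGerm φ (d x) b = multGerm φ (d x) c) :
    multGerm φ (r x) (β.act s b) = multGerm φ (r x) (β.act t c) := by
  obtain ⟨w, hxw, hw⟩ := hS.exists_mem_subset
    ((S.isOpenGSet _ s.2).1.inter (S.isOpenGSet _ t.2).1) ⟨hxs, hxt⟩
  obtain ⟨a, ha, hab⟩ := h.exists_mem_ideal_multGerm_eq hxw (multGerm φ (d x) b)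
  obtain ⟨has, hs⟩ := β.act_of_subset (hw.trans inter_subset_left) ha
  obtain ⟨hat, ht⟩ := β.act_of_subset (hw.trans inter_subset_right) ha
  rw [h.multGerm_act_eq_of_multGerm_eq hS hxs hb has hab.symm, ← hs, ht,
    h.multGerm_act_eq_of_multGerm_eq hS hxt hat hc (hab.trans hbc)]

/-- The homomorphism `α_x` of the fibres. -/
theorem exists_germHom (h : β.IsCompatible φ) (hS : S.IsFull) (x : G) :
    ∃ γ : MultFiber φ (d x) →⋆ₙₐ[ℂ] MultFiber φ (r x), ∀ s : S.Elem, x ∈ (s : Set G) →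
      ∀ b ∈ β.ideal s, γ (multGerm φ (d x) b) = multGerm φ (r x) (β.act s b) := by
  obtain ⟨s, hxs, -⟩ := hS.exists_mem_subset isOpen_univ (mem_univ x)
  choose L hL hLa using fun a => h.exists_mem_ideal_multGerm_eq (φ := φ) hxs a
  have key : ∀ t : S.Elem, x ∈ (t : Set G) → ∀ b ∈ β.ideal t, ∀ a, multGerm φ (d x) b = a →
      multGerm φ (r x) (β.act s (L a)) = multGerm φ (r x) (β.act t b) := fun t ht b hb a hba =>
    h.multGerm_act_eq hS hxs ht (hL _) hb ((hLa a).trans hba.symm)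
  have hI := (β.toFun s).source_ideal
  refine ⟨
    -- by `key`, neither `s` nor the representative `L a` of the germ `a` matters
    { toFun := fun a => multGerm φ (r x) (β.act s (L a))
      map_smul' := fun c a => ?_
      map_zero' := ?_
      map_add' := fun a b => ?_
      map_mul' := fun a b => ?_
      map_star' := fun a => ?_ }, fun t ht b hb => key t ht b hb _ rfl⟩
  · rw [key s hxs (c • L a) (hI.smul_mem c _ (hL a)) _ (by rw [multGerm_smul, hLa]),
      show β.act s (c • L a) = c • β.act s (L a) from (β.toFun s).map_smul c _ (hL a)]
    rfl
  · change multGerm φ (r x) (β.act s (L 0)) = 0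
    rw [key s hxs 0 hI.zero_mem 0 rfl, β.act_zero, multGerm_zero]
  · change multGerm φ (r x) (β.act s (L (a + b))) = _
    rw [key s hxs (L a + L b) (hI.add_mem _ (hL a) _ (hL b)) _ (by rw [multGerm_add, hLa, hLa]),
      show β.act s (L a + L b) = _ from (β.toFun s).map_add _ (hL a) _ (hL b)]
    rfl
  · change multGerm φ (r x) (β.act s (L (a * b))) = _
    rw [key s hxs (L a * L b) (hI.mul_mem_left _ _ (hL b)) _ (by rw [multGerm_mul, hLa, hLa]),
      show β.act s (L a * L b) = _ from (β.toFun s).map_mul _ (hL a) _ (hL b)]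
    rfl
  · rw [key s hxs (star (L a)) (h.star_mem_ideal (hL a)) _ (by rw [multGerm_star, hLa]),
      show β.act s (star (L a)) = _ from (β.toFun s).map_star _ (hL a)]
    rfl

theorem fiberCast_multGerm {u v : units G} (huv : u = v) (b : B) :
    (multBundle φ).fiberCast huv (multGerm φ u b) = multGerm φ v b := by
  subst huv
  rfl

/-- Homomorphisms of the fibres induced by the partial automorphisms form an action of `G`. -/
theorem isGroupoidAction (h : β.IsCompatible φ) (hS : S.IsFull)
    (α : ∀ x : G, (multBundle φ).Fiber (d x) →⋆ₙₐ[ℂ] (multBundle φ).Fiber (r x))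
    (hα : ∀ (x : G) (s : S.Elem), x ∈ (s : Set G) → ∀ b ∈ β.ideal s,
      α x (multGerm φ (d x) b) = multGerm φ (r x) (β.act s b)) :
    IsGroupoidAction (multBundle φ) α where
  map_unit u a := by
    obtain ⟨e, hue, he⟩ := hS.exists_mem_subset isOpen_units u.2
    obtain ⟨b, hb, rfl⟩ := h.exists_mem_ideal_multGerm_eq hue a
    rw [hα _ e hue b hb, β.act_of_isIdempotentElem (isIdempotentElem_of_subset_units he) hb,
      fiberCast_multGerm, fiberCast_multGerm]
  map_gmul x y hxy a := by
    obtain ⟨s, hxs, -⟩ := hS.exists_mem_subset isOpen_univ (mem_univ x)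
    obtain ⟨t, hyt, -⟩ := hS.exists_mem_subset isOpen_univ (mem_univ y)
    have hmem : gmul x y ∈ ((s * t : S.Elem) : Set G) := ⟨x, hxs, y, hyt, hxy, rfl⟩
    obtain ⟨b, hb, rfl⟩ := h.exists_mem_ideal_multGerm_eq hmem a
    obtain ⟨hbt, hbs⟩ := (β.mem_ideal_mul).1 hb
    rw [hα _ _ hmem b hb, β.act_mul hb, fiberCast_multGerm, fiberCast_multGerm, hα y t hyt b hbt,
      fiberCast_multGerm, hα x s hxs _ hbs]
  continuous_act := by
    have hr : Continuous (r : G → units G) := IsRDiscrete.isLocalHomeomorph_r.continuous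
    refine continuous_iff_continuousAt.2 fun ⟨x, a⟩ => ?_
    obtain ⟨s, hxs, -⟩ := hS.exists_mem_subset isOpen_univ (mem_univ x)
    obtain ⟨b, hb, rfl⟩ := h.exists_mem_ideal_multGerm_eq hxs a
    have hpair : Continuous fun p : BundlePullback (d : G → units G) (multBundle φ).Fiber =>
        ((p.base, ⟨d p.base, p.val⟩) : G × BundleTotal (multBundle φ).Fiber) :=
      continuous_induced_dom
    have hbase := hpair.fst.tendsto (⟨x, multGerm φ (d x) b⟩ : BundlePullback d _)
    have hval := (tendsto_nhds_multGerm.1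
      (hpair.snd.tendsto (⟨x, multGerm φ (d x) b⟩ : BundlePullback d _))).2
    change Tendsto _ _ (𝓝 (⟨r x, α x (multGerm φ (d x) b)⟩ : BundleTotal (MultFiber φ)))
    rw [hα x s hxs b hb]
    refine tendsto_nhds_multGerm.2 ⟨(hr.tendsto x).comp hbase, ?_⟩
    refine squeeze_zero' (Eventually.of_forall fun _ => norm_nonneg _) ?_ hval
    filter_upwards [hbase.eventually ((S.isOpenGSet _ s.2).1.mem_nhds hxs)] with p hp
    change ‖α p.base p.val - multGerm φ (r p.base) (β.act s b)‖ ≤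
      ‖p.val - multGerm φ (d p.base) b‖
    rw [← hα p.base s hp b hb]
    refine le_trans (le_of_eq ?_)
      (NonUnitalStarAlgHom.norm_apply_le (α p.base) (p.val - multGerm φ (d p.base) b))
    rw [map_sub]

end IsCompatible
end InverseSemigroupAction

theorem mainTheorem4
    {G : Type v} [TopologicalSpace G] [TopGroupoid G] [TopGroupoid.IsRDiscrete G]
    (S : TopGroupoid.InverseSubsemigroup G) (hS : S.IsFull)
    {B : Type u} [NonUnitalCStarAlgebra B]
    (β : InverseSemigroupAction S.Elem B)
    (φ : C₀(TopGroupoid.units G, ℂ) →⋆ₙₐ[ℂ] CentralMult B)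
    (hφ_inj : Function.Injective φ)
    (hφ_nondeg : MultNondegenerate φ)
    (hφβ : ∀ e : S.Elem, IsIdempotentElem e → multIdeal φ (vanishOff (e : Set G)) = β.ideal e) :
    ∃ (A : USCCStarBundle.{u, v} (TopGroupoid.units G)) (Φ : B ≃⋆ₐ[ℂ] A.Gamma0),
      -- `Φ` is isometric for the supremum norm on `Γ₀(A)`
      (∀ (b : B) (c : ℝ), 0 ≤ c → (‖b‖ ≤ c ↔ ∀ u, ‖(Φ b).1 u‖ ≤ c)) ∧
      -- `Φ` carries `φ` to pointwise multiplication
      (∀ (f : C₀(TopGroupoid.units G, ℂ)) (b : B) (u : TopGroupoid.units G),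
        (Φ (multAct φ f b)).1 u = f u • (Φ b).1 u) ∧
      -- `b ↦ Φ(b)(u)` identifies the fibre over `u` with `B / φ(I_u) B`
      (∀ u : TopGroupoid.units G,
        Function.Surjective (fun b : B => (Φ b).1 u) ∧
        {b : B | (Φ b).1 u = 0} = multIdeal φ (vanishAt u)) ∧
      -- there are unique germ maps, and they form an action of `G` on `A`
      ∃ α : ∀ x : G, A.Fiber (TopGroupoid.d x) →⋆ₙₐ[ℂ] A.Fiber (TopGroupoid.r x),
        (∀ x : G, (∀ s : S.Elem, x ∈ (s : Set G) → ∀ b ∈ β.ideal s,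
            α x ((Φ b).1 (TopGroupoid.d x)) = (Φ (β.act s b)).1 (TopGroupoid.r x)) ∧
          ∀ γ : A.Fiber (TopGroupoid.d x) →⋆ₙₐ[ℂ] A.Fiber (TopGroupoid.r x),
            (∀ s : S.Elem, x ∈ (s : Set G) → ∀ b ∈ β.ideal s,
              γ ((Φ b).1 (TopGroupoid.d x)) = (Φ (β.act s b)).1 (TopGroupoid.r x)) →
            γ = α x) ∧
        IsGroupoidAction A α := by
  have : LocallyCompactSpace (TopGroupoid.units G) :=
    TopGroupoid.isOpen_units.locallyCompactSpace
  have : Fact (MultNondegenerate φ) := ⟨hφ_nondeg⟩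
  have hc : β.IsCompatible φ := hφβ
  choose α hα using hc.exists_germHom hS
  refine ⟨multBundle φ, multSectionEquiv φ, fun b c hc0 => ⟨fun hb u => ?_, fun hb => ?_⟩,
    fun f b u => multGerm_multAct u f b, fun u => ⟨multGerm_surjective u, ?_⟩, α,
    fun x => ⟨hα x, fun γ hγ => ?_⟩, hc.isGroupoidAction hS α hα⟩
  · exact (norm_multGerm_le u b).trans hb
  · exact norm_le_of_forall_norm_multGerm_le (φ := φ) hc0 hb
  · ext b
    rw [← mem_multSubmodule]
    exact multGerm_eq_zero_iff
  · obtain ⟨s, hxs, -⟩ := hS.exists_mem_subset isOpen_univ (mem_univ x)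
    refine NonUnitalStarAlgHom.ext fun a => ?_
    obtain ⟨b, hb, rfl⟩ := hc.exists_mem_ideal_multGerm_eq hxs a
    exact (hγ s hxs b hb).trans (hα x s hxs b hb).symm
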